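/- A lattice $\Lambda\subset\mathbb R^n$ is the set of all integer linear combinations of linearly independent vectors $B=(b_1,\dots,b_k)$ in $\mathbb R^n$ ($k\ge 1$, not necessarily $k=n$); $\det\Lambda=\sqrt{\det(B^{T}B)}$, and $\Lambda^*=\{y\in\operatorname{span}\Lambda:\langle y,x\rangle\in\mathbb Z\ \forall x\in\Lambda\}$ is the dual lattice. A subspace $W\subseteq\mathbb R^n$ is a lattice subspace of $\Lambda^*$ if it has a basis of vectors of $\Lambda^*$. The covering radius is $\mu(\Lambda)=\inf\{r\ge 0:\operatorname{span}\Lambda\subseteq\Lambda+rB_2^n\}$, where $B_2^n$ is the closed unit Euclidean ball, and the smoothing parameter $\eta(\Lambda)$ is the unique $s>0$ with $\sum_{y\in\Lambda^*}e^{-\pi\|sy\|_2^2}=3/2$. For $n\ge 1$ let $C_\eta(n)$ be the smallest number such that for every lattice $\Lambda\subset\mathbb R^n$ $$\eta(\Lambda)\le C_\eta(n)\max_{W\ne\{0\}\text{ lattice subspace of }\Lambda^*}\det(\Lambda^*\cap W)^{-1/\dim W},$$ and let $C_{KL}(n)$ be the smallest number such that for every lattice $\Lambda\subset\mathbb R^n$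 $$\mu(\Lambda)\le C_{KL}(n)\max_{\substack{W\text{ lattice subspace of }\Lambda^*\\ 1\le d=\dim W\le n}}\frac{\sqrt d}{\det(\Lambda^*\cap W)^{1/d}}.$$ **Theorem.** There is a universal constant $c>0$ such that for all $n\ge 2$ we have $C_{KL}(n)\le c\,\log n\cdot C_\eta(n)$; that is, every lattice $\Lambda\subset\mathbb R^n$ satisfies $$\mu(\Lambda)\le c\,\log n\cdot C_\eta(n)\max_{\substack{W\text{ lattice subspace of }\Lambda^*\\ 1\le d=\dim W\le n}}\frac{\sqrt d}{\det(\Lambda^*\cap W)^{1/d}}.$$ In particular, if $C_\eta(n)\le\operatorname{poly}\log n$ (for $n\ge2$), i.e. the main conjecture holds, then $C_{KL}(n)\le\operatorname{poly}\log n$ (for $n\ge2$), i.e. the $\ell_2$ Kannan–Lovász conjecture holds. -/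

import Mathlib

open scoped ENNReal

noncomputable section

namespace EuclideanLattice

/-- The Euclidean space `ℝⁿ` with the `ℓ₂` norm. -/
abbrev Space (n : ℕ) : Type := EuclideanSpace ℝ (Fin n)

/-- `b` is a basis of the lattice `L`: linearly independent vectors of `ℝⁿ` whose integer linear
combinations are exactly the elements of `L`. -/
def IsBasis {n d : ℕ} (L : Submodule ℤ (Space n)) (b : Fin d → Space n) : Prop :=
  LinearIndependent ℝ b ∧ Submodule.span ℤ (Set.range b) = L

/-- A Euclidean lattice in `ℝⁿ`, of arbitrary rank `d ≤ n`. -/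
def IsLattice {n : ℕ} (L : Submodule ℤ (Space n)) : Prop :=
  ∃ (d : ℕ) (b : Fin d → Space n), IsBasis L b

/-- `√(det (BᵀB))` for the matrix `B` with columns `b i`. -/
def gramVolume {n d : ℕ} (b : Fin d → Space n) : ℝ :=
  Real.sqrt (Matrix.det (Matrix.of fun i j => inner ℝ (b i) (b j)))

/-- The determinant of a lattice, `√(det (BᵀB))` for a basis `B`. The set below has exactly one
element when `L` is a lattice, see `det_eq_gramVolume`. -/
def det {n : ℕ} (L : Submodule ℤ (Space n)) : ℝ :=
  sInf {v : ℝ | ∃ (d : ℕ) (b : Fin d → Space n), IsBasis L b ∧ v = gramVolume b}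

theorem gramVolume_eq_of_isBasis {n d e : ℕ} {L : Submodule ℤ (Space n)}
    {b : Fin d → Space n} {c : Fin e → Space n} (hb : IsBasis L b) (hc : IsBasis L c) :
    gramVolume b = gramVolume c := by
  have key : ∀ {d e : ℕ} {b : Fin d → Space n} {c : Fin e → Space n},
      IsBasis L b → IsBasis L c → ∃ P : Matrix (Fin d) (Fin e) ℤ,
        ∀ i, b i = ∑ j, P i j • c j := by
    intro d e b c hb hc
    have h : ∀ i, ∃ p : Fin e → ℤ, ∑ j, p j • c j = b i := by
      intro i
      have : b i ∈ Submodule.span ℤ (Set.range c) := by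
        rw [hc.2, ← hb.2]
        exact Submodule.subset_span ⟨i, rfl⟩
      exact (Submodule.mem_span_range_iff_exists_fun ℤ).1 this
    choose p hp using h
    exact ⟨p, fun i => (hp i).symm⟩
  have hspan : ∀ {d : ℕ} {b : Fin d → Space n}, IsBasis L b →
      Submodule.span ℝ (Set.range b) = Submodule.span ℝ (L : Set (Space n)) := by
    intro d b hb
    rw [← hb.2, Submodule.span_span_of_tower]
  have hde : d = e := by
    have h1 := finrank_span_eq_card hb.1
    have h2 := finrank_span_eq_card hc.1
    rw [hspan hb] at h1
    rw [hspan hc] at h2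
    simpa using h1.symm.trans h2
  subst hde
  obtain ⟨P, hP⟩ := key hb hc
  obtain ⟨Q, hQ⟩ := key hc hb
  have hli : LinearIndependent ℤ b := hb.1.restrict_scalars (by
    intro x y hxy
    simpa using hxy)
  have hPQ : P * Q = 1 := by
    ext i k
    have h : ∑ k, (P * Q) i k • b k = ∑ k, (1 : Matrix (Fin d) (Fin d) ℤ) i k • b k := by
      have h1 : ∑ k, (1 : Matrix (Fin d) (Fin d) ℤ) i k • b k = b i := by
        simp [Matrix.one_apply]
      rw [h1]
      conv_rhs => rw [hP i]
      simp_rw [Matrix.mul_apply, Finset.sum_smul]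
      rw [Finset.sum_comm]
      refine Finset.sum_congr rfl fun j _ => ?_
      rw [hQ j, Finset.smul_sum]
      simp_rw [mul_smul]
    have h' : ∑ k, ((P * Q) i k - (1 : Matrix (Fin d) (Fin d) ℤ) i k) • b k = 0 := by
      simp_rw [sub_smul, Finset.sum_sub_distrib, h, sub_self]
    have := Fintype.linearIndependent_iff.1 hli _ h' k
    linarith
  have hdet : (P.det : ℝ) * P.det = 1 := by
    have h1 : P.det * Q.det = 1 := by rw [← Matrix.det_mul, hPQ, Matrix.det_one]
    rcases Int.eq_one_or_neg_one_of_mul_eq_one h1 with h | h <;> simp [h]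
  have hgram : (Matrix.of fun i j => inner ℝ (b i) (b j)) =
      (P.map (Int.castRingHom ℝ)) * (Matrix.of fun i j => inner ℝ (c i) (c j)) *
        (P.map (Int.castRingHom ℝ)).transpose := by
    ext i k
    simp only [Matrix.of_apply, Matrix.mul_apply, Matrix.map_apply, Matrix.transpose_apply]
    rw [hP i, hP k, sum_inner]
    simp_rw [inner_sum, Finset.sum_mul]
    rw [Finset.sum_comm]
    refine Finset.sum_congr rfl fun j _ => Finset.sum_congr rfl fun l _ => ?_
    rw [← Int.cast_smul_eq_zsmul ℝ, ← Int.cast_smul_eq_zsmul ℝ, real_inner_smul_left,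
      real_inner_smul_right]
    simp
    ring
  unfold gramVolume
  congr 1
  rw [hgram, Matrix.det_mul, Matrix.det_mul, Matrix.det_transpose]
  have : (P.map (Int.castRingHom ℝ)).det = (P.det : ℝ) := by
    simpa using (RingHom.map_det (Int.castRingHom ℝ) P).symm
  rw [this]
  linear_combination (Matrix.det (Matrix.of fun i j => inner ℝ (c i) (c j))) * hdet

/-- The determinant of a lattice may be computed from any of its bases. -/
theorem det_eq_gramVolume {n d : ℕ} {L : Submodule ℤ (Space n)} {b : Fin d → Space n}
    (hb : IsBasis L b) : det L = gramVolume b := by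
  have : {v : ℝ | ∃ (d : ℕ) (b : Fin d → Space n), IsBasis L b ∧ v = gramVolume b} =
      {gramVolume b} := by
    ext v
    constructor
    · rintro ⟨e, c, hc, rfl⟩
      exact gramVolume_eq_of_isBasis hc hb
    · rintro rfl
      exact ⟨d, b, hb, rfl⟩
  rw [det, this, csInf_singleton]

/-- The dual lattice `L* = {y ∈ span L : ⟨y, x⟩ ∈ ℤ for all x ∈ L}`. -/
def dual {n : ℕ} (L : Submodule ℤ (Space n)) : Submodule ℤ (Space n) where
  carrier := {y | y ∈ Submodule.span ℝ (L : Set (Space n)) ∧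
    ∀ x ∈ L, ∃ k : ℤ, inner ℝ y x = (k : ℝ)}
  zero_mem' := ⟨Submodule.zero_mem _, fun _ _ => ⟨0, by simp⟩⟩
  add_mem' := by
    rintro y z ⟨hy, hy'⟩ ⟨hz, hz'⟩
    refine ⟨Submodule.add_mem _ hy hz, fun x hx => ?_⟩
    obtain ⟨k, hk⟩ := hy' x hx
    obtain ⟨l, hl⟩ := hz' x hx
    exact ⟨k + l, by rw [inner_add_left, hk, hl]; push_cast; rfl⟩
  smul_mem' := by
    rintro m y ⟨hy, hy'⟩
    refine ⟨?_, fun x hx => ?_⟩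
    · rw [← Int.cast_smul_eq_zsmul ℝ]
      exact Submodule.smul_mem _ _ hy
    · obtain ⟨k, hk⟩ := hy' x hx
      exact ⟨m * k, by
        rw [← Int.cast_smul_eq_zsmul ℝ, real_inner_smul_left, hk]; push_cast; rfl⟩

/-- `W` is a lattice subspace of `L` if `W` admits a basis of vectors in `L`. -/
def IsLatticeSubspace {n : ℕ} (L : Submodule ℤ (Space n)) (W : Submodule ℝ (Space n)) : Prop :=
  ∃ b : Module.Basis (Fin (Module.finrank ℝ W)) ℝ W, ∀ i, (b i : Space n) ∈ L

/-- The lattice `L ∩ W`. -/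
def inter {n : ℕ} (L : Submodule ℤ (Space n)) (W : Submodule ℝ (Space n)) :
    Submodule ℤ (Space n) :=
  L ⊓ W.restrictScalars ℤ

/-- The covering radius `μ(L) = inf {r ≥ 0 : span L ⊆ L + r B₂ⁿ}`. -/
def coveringRadius {n : ℕ} (L : Submodule ℤ (Space n)) : ℝ :=
  sInf {r : ℝ | 0 ≤ r ∧ ∀ x ∈ Submodule.span ℝ (L : Set (Space n)), ∃ v ∈ L, ‖x - v‖ ≤ r}

/-- The `ε`-smoothing parameter: the `s > 0` with `∑_{y ∈ L*} exp (-π ‖s y‖²) = 1 + ε`.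
For a nonzero lattice and `ε > 0` there is exactly one such `s`. -/
def smoothingParameterEps {n : ℕ} (ε : ℝ) (L : Submodule ℤ (Space n)) : ℝ :=
  sInf {s : ℝ | 0 < s ∧
    HasSum (fun y : dual L => Real.exp (-Real.pi * ‖s • (y : Space n)‖ ^ 2)) (1 + ε)}

/-- The smoothing parameter `η(L) = η_{1/2}(L)`. -/
def smoothingParameter {n : ℕ} (L : Submodule ℤ (Space n)) : ℝ :=
  smoothingParameterEps (1 / 2) L

/-- The maximum of `det(L* ∩ W)^{-1/dim W}` over the lattice subspaces `W ≠ {0}` of `L*`. -/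
def etaDet {n : ℕ} (L : Submodule ℤ (Space n)) : ℝ≥0∞ :=
  ⨆ (W : Submodule ℝ (Space n)) (_ : IsLatticeSubspace (dual L) W) (_ : W ≠ ⊥),
    ENNReal.ofReal (det (inter (dual L) W) ^ (-(1 / (Module.finrank ℝ W : ℝ))))

/-- The maximum of `√d · det(L* ∩ W)^{-1/d}` over the lattice subspaces `W` of `L*` of dimension
`d ≥ 1`. -/
def muDet {n : ℕ} (L : Submodule ℤ (Space n)) : ℝ≥0∞ :=
  ⨆ (W : Submodule ℝ (Space n)) (_ : IsLatticeSubspace (dual L) W)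
    (_ : 1 ≤ Module.finrank ℝ W),
    ENNReal.ofReal (Real.sqrt (Module.finrank ℝ W) *
      det (inter (dual L) W) ^ (-(1 / (Module.finrank ℝ W : ℝ))))

/-- `C_η(n)`: the smallest `C` with `η(L) ≤ C · max_W det(L* ∩ W)^{-1/dim W}` for every lattice
`L ⊂ ℝⁿ`, as an element of `[0, ∞]`. -/
def Ceta (n : ℕ) : ℝ≥0∞ :=
  sInf {C : ℝ≥0∞ | ∀ L : Submodule ℤ (Space n), IsLattice L → L ≠ ⊥ →
    ENNReal.ofReal (smoothingParameter L) ≤ C * etaDet L}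

/-- `C_KL(n)`: the smallest `C` with `μ(L) ≤ C · max_W √d · det(L* ∩ W)^{-1/d}` for every lattice
`L ⊂ ℝⁿ`, as an element of `[0, ∞]`. -/
def CKL (n : ℕ) : ℝ≥0∞ :=
  sInf {C : ℝ≥0∞ | ∀ L : Submodule ℤ (Space n), IsLattice L → L ≠ ⊥ →
    ENNReal.ofReal (coveringRadius L) ≤ C * muDet L}

/-- `F(n) ≤ poly log n`. -/
def PolylogBounded (F : ℕ → ℝ≥0∞) : Prop :=
  ∃ p : Polynomial ℝ, ∀ n : ℕ, 2 ≤ n → F n ≤ ENNReal.ofReal (p.eval (Real.log n))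

end EuclideanLattice

end

noncomputable section

namespace EuclideanLattice

open MeasureTheory Module

/-! Put M = L*, C = C_η(n), and let K be the maximum on the right-hand side. Poisson summation gives
μ(L) ≤ √d · η(L) for a lattice of rank d (`covers_smoothingParameter`). Applied to L at once this
loses a factor √n, so L is cut along a filtration of M by almost extremal lattice subspaces, in the
manner of a canonical (Harder–Narasimhan) filtration.

Choose W of dimension d whose det(M ∩ W)^(-1/d) is within a factor q of the supremum τ. The dual of
M ∩ W is the projection of L to W; its smoothing parameter is at most Cτ, so it covers W with radius
√d · Cτ. The dual of the projection of M to Wᗮ is L ∩ Wᗮ, to which the argument is applied again,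
and the squared radii add (`Covers.dual`). Extremality of W keeps the next supremum below τ q^d
(`DetBound.proj_orthogonal`).

Hence, if D dimensions were removed before W, then τ^(D+d) is at most twice the inverse determinant
of the (D+d)-dimensional part removed so far, and the definition of K yields (D+d) τ² ≤ 4K²
(`add_mul_sq_le_of_tight`). The step costs at most 4C²K² · d/(D+d) in squared radius, and d/(D+d) is
at most the sum of 1/i over D < i ≤ D+d. These sums concatenate to a harmonic number
(`covers_dual_of_detBound`), so μ(L) ≤ 2CK √(1 + log n), which is better than needed. -/

/-! ### Convergence and continuity of Gaussian sums over discrete groups. -/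

theorem exp_neg_mul_sq_le_inv_pow {a : ℝ} (ha : 0 < a) (m : ℕ) {t : ℝ} (ht : t ≠ 0) :
    Real.exp (-a * t ^ 2) ≤ m.factorial / a ^ m * t⁻¹ ^ (2 * m) := by
  have h := Real.pow_div_factorial_le_exp (a * t ^ 2) (by positivity) m
  have ht2 : 0 < t ^ 2 := by positivity
  rw [neg_mul, Real.exp_neg, pow_mul, inv_pow, inv_pow, ← div_eq_mul_inv, div_div, ← mul_pow,
    ← inv_div]
  exact inv_anti₀ (by positivity) h

/-- Gaussian sums over discrete subgroups converge. -/
theorem summable_exp_neg_mul_norm_sq {E : Type*} [NormedAddCommGroup E] [NormedSpace ℝ E]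
    [FiniteDimensional ℝ E] (L : Submodule ℤ E) [DiscreteTopology L] {a : ℝ} (ha : 0 < a) :
    Summable fun v : L => Real.exp (-a * ‖(v : E)‖ ^ 2) := by
  -- Power sums of exponent 2m converge once 2m exceeds the rank; the comparison may fail only at
  -- the zero vector, where the inverse power vanishes.
  set m := finrank ℤ L + 1
  have h := (ZLattice.summable_norm_pow_inv L (2 * m) (by omega)).mul_left
    (m.factorial / a ^ m : ℝ)
  refine h.of_norm_bounded_eventually ?_
  refine ((Set.finite_singleton (0 : L)).subset fun v hv => ?_)
  by_contra hv0
  refine hv ?_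
  change ‖Real.exp (-a * ‖(v : E)‖ ^ 2)‖ ≤ _
  rw [Real.norm_of_nonneg (Real.exp_nonneg _)]
  exact exp_neg_mul_sq_le_inv_pow ha m (by simpa using hv0)

section Gaussian

/-- Giving up half of the exponent separates v from x, so one summable majorant serves all x in a
ball. -/
theorem exp_neg_mul_norm_add_sq_le {E : Type*} [NormedAddCommGroup E] {a : ℝ} (ha : 0 < a) (v x : E) :
    Real.exp (-a * ‖v + x‖ ^ 2) ≤ Real.exp (a * ‖x‖ ^ 2) * Real.exp (-(a / 2) * ‖v‖ ^ 2) := by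
  rw [← Real.exp_add, Real.exp_le_exp]
  have h : ‖v‖ ≤ ‖v + x‖ + ‖x‖ := by simpa using norm_sub_le (v + x) x
  have h2 : ‖v‖ ^ 2 ≤ 2 * ‖v + x‖ ^ 2 + 2 * ‖x‖ ^ 2 := by
    nlinarith [sq_nonneg (‖v + x‖ - ‖x‖), norm_nonneg v]
  nlinarith

/-- The periodic Gaussian sum `x ↦ ∑_{v ∈ L} exp (-a ‖v + x‖²)`. -/
def periodicGaussian {E : Type*} [NormedAddCommGroup E] (L : Submodule ℤ E) (a : ℝ) (x : E) : ℝ :=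
  ∑' v : L, Real.exp (-a * ‖(v : E) + x‖ ^ 2)

theorem periodicGaussian_add {E : Type*} [NormedAddCommGroup E] (L : Submodule ℤ E) (a : ℝ) (x : E) {u : E} (hu : u ∈ L) :
    periodicGaussian L a (x + u) = periodicGaussian L a x := by
  unfold periodicGaussian
  rw [← (Equiv.addRight (⟨u, hu⟩ : L)).tsum_eq fun v : L => Real.exp (-a * ‖(v : E) + x‖ ^ 2)]
  refine tsum_congr fun v => ?_
  rw [Equiv.coe_addRight, Submodule.coe_add, add_assoc, add_comm u x]

variable {E : Type*} [NormedAddCommGroup E] [InnerProductSpace ℝ E] [FiniteDimensional ℝ E]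

theorem summable_exp_neg_mul_norm_add_sq (L : Submodule ℤ E) [DiscreteTopology L] {a : ℝ}
    (ha : 0 < a) (x : E) : Summable fun v : L => Real.exp (-a * ‖(v : E) + x‖ ^ 2) :=
  ((summable_exp_neg_mul_norm_sq L (half_pos ha)).mul_left _).of_nonneg_of_le
    (fun _ => Real.exp_nonneg _) fun v => exp_neg_mul_norm_add_sq_le ha (v : E) x

theorem continuous_periodicGaussian (L : Submodule ℤ E) [DiscreteTopology L] {a : ℝ}
    (ha : 0 < a) : Continuous (periodicGaussian L a) := by
  rw [continuous_iff_continuousAt]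
  intro x
  have hs : Metric.ball (0 : E) (‖x‖ + 1) ∈ nhds x :=
    Metric.isOpen_ball.mem_nhds (by simp)
  refine ContinuousOn.continuousAt (s := Metric.ball 0 (‖x‖ + 1)) ?_ hs
  refine continuousOn_tsum (u := fun v : L => Real.exp (a * (‖x‖ + 1) ^ 2) *
    Real.exp (-(a / 2) * ‖(v : E)‖ ^ 2)) (fun v => by fun_prop)
    ((summable_exp_neg_mul_norm_sq L (half_pos ha)).mul_left _) fun v y hy => ?_
  rw [Real.norm_of_nonneg (Real.exp_nonneg _)]
  refine (exp_neg_mul_norm_add_sq_le ha _ y).trans ?_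
  gcongr
  exact (mem_ball_zero_iff.1 hy).le

end Gaussian

/-! ### Poisson summation for Gaussians. -/

section Poisson

variable {E : Type*} [NormedAddCommGroup E] [InnerProductSpace ℝ E] [FiniteDimensional ℝ E]
  [MeasurableSpace E] [BorelSpace E] {ι : Type*} [Fintype ι]

/-- Integrals over the unit cube are integrals over the fundamental domain, up to a constant. -/
theorem exists_setIntegral_cube_eq (b : Basis ι ℝ E) : ∃ c : ℝ, 0 < c ∧ ∀ Φ : E → ℂ,
    ∫ θ in {θ : ι → ℝ | ∀ i, θ i ∈ Set.Ioc (0 : ℝ) (0 + 1)}, Φ (b.equivFun.symm θ) =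
      c * ∫ x in ZSpan.fundamentalDomain b, Φ x := by
  set e : (ι → ℝ) ≃L[ℝ] E := b.equivFun.symm.toContinuousLinearEquiv
  -- Uniqueness of Haar measure supplies c. Its value is irrelevant, since it cancels when two
  -- Gaussian widths are compared.
  have hmap : (Measure.map e volume).IsAddHaarMeasure := e.isAddHaarMeasure_map _
  refine ⟨(Measure.addHaarScalarFactor (Measure.map e volume) volume : NNReal), ?_, fun Φ => ?_⟩
  · exact_mod_cast Measure.addHaarScalarFactor_pos_of_isAddHaarMeasure _ _
  -- The torus integral uses the cube (0,1]^ι and the fundamental domain uses [0,1)^ι; they differ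
  -- by a null set.
  have h1 : ({θ : ι → ℝ | ∀ i, θ i ∈ Set.Ioc (0 : ℝ) (0 + 1)} : Set (ι → ℝ)) =ᵐ[volume]
      e ⁻¹' (ZSpan.fundamentalDomain b) := by
    have h2 : e ⁻¹' (ZSpan.fundamentalDomain b) =
        Set.univ.pi fun _ : ι => Set.Ico (0 : ℝ) (0 + 1) := by
      ext θ
      have h : ∀ i, b.repr (e θ) i = θ i := fun i =>
        congrFun (b.equivFun.apply_symm_apply θ) i
      simp [ZSpan.mem_fundamentalDomain, h]
    have h3 : {θ : ι → ℝ | ∀ i, θ i ∈ Set.Ioc (0 : ℝ) (0 + 1)} =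
        Set.univ.pi fun _ : ι => Set.Ioc (0 : ℝ) (0 + 1) := by
      ext θ
      simp
    rw [h2, h3]
    exact (Measure.univ_pi_Ioc_ae_eq_Icc).trans Measure.univ_pi_Ico_ae_eq_Icc.symm
  rw [setIntegral_congr_set h1]
  have h4 := e.toHomeomorph.measurableEmbedding.setIntegral_map (μ := volume) Φ
    (ZSpan.fundamentalDomain b)
  refine h4.symm.trans ?_
  change ∫ y in ZSpan.fundamentalDomain b, Φ y ∂(Measure.map e volume) = _
  conv_lhs => rw [Measure.isAddLeftInvariant_eq_smul (Measure.map e volume) volume]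
  rw [Measure.restrict_smul, integral_smul_nnreal_measure]
  simp [NNReal.smul_def]

/-- Unfolding: χ is lattice-periodic, so the integrand is the sum of all lattice translates of χ
times one Gaussian, and the translated cells tile the space. -/
theorem setIntegral_periodicGaussian_mul (b : Basis ι ℝ E) {a : ℝ} (ha : 0 < a) (χ : E → ℂ)
    (hχ : Continuous χ) (hχ1 : ∀ x, ‖χ x‖ = 1)
    (hper : ∀ x, ∀ v ∈ Submodule.span ℤ (Set.range b), χ (v + x) = χ x) :
    ∫ x in ZSpan.fundamentalDomain b,
      χ x * periodicGaussian (Submodule.span ℤ (Set.range b)) a x =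
    ∫ x, χ x * Real.exp (-a * ‖x‖ ^ 2) := by
  set L := Submodule.span ℤ (Set.range b)
  have : VAddInvariantMeasure L E volume :=
    ⟨fun v s _ => measure_preimage_add volume (v : E) s⟩
  have hfund : IsAddFundamentalDomain L _ volume := ZSpan.isAddFundamentalDomain b (volume : Measure E)
  set g : E → ℂ := fun x => χ x * Real.exp (-a * ‖x‖ ^ 2) with hg
  have hgc : Continuous g := by fun_prop
  have hint : Integrable g := by
    have h := GaussianFourier.integrable_cexp_neg_mul_sq_norm_add (b := (a : ℂ)) (V := E)
      (by simpa using ha) 0 0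
    refine h.norm.mono' hgc.aestronglyMeasurable (Filter.Eventually.of_forall fun x => ?_)
    rw [hg]
    simp only [norm_mul, hχ1, one_mul, zero_mul, add_zero]
    push_cast
    exact le_rfl
  rw [hfund.integral_eq_tsum'' g hint, ← integral_tsum]
  · refine integral_congr_ae (Filter.Eventually.of_forall fun x => ?_)
    simp only [periodicGaussian, Complex.ofReal_tsum]
    rw [← tsum_mul_left]
    refine tsum_congr fun v => ?_
    have hv : v +ᵥ x = (v : E) + x := rfl
    rw [hv, hg]
    simp only [hper x v v.2]
  · intro v
    exact (hgc.comp (continuous_const_vadd v)).aestronglyMeasurable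
  · rw [← hfund.lintegral_eq_tsum'' (fun x => ‖g x‖ₑ)]
    exact hint.2.ne

end Poisson

theorem mFourier_coe_apply {ι : Type*} [Fintype ι] (k : ι → ℤ) (θ : ι → ℝ) :
    UnitAddTorus.mFourier k (fun i => (θ i : UnitAddCircle)) =
      Complex.exp (((2 * Real.pi * ∑ i, k i * θ i : ℝ) : ℂ) * Complex.I) := by
  simp only [UnitAddTorus.mFourier, ContinuousMap.coe_mk, fourier_coe_apply, ← Complex.exp_sum]
  congr 1
  push_cast
  rw [Finset.mul_sum, Finset.sum_mul]
  refine Finset.sum_congr rfl fun i _ => ?_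
  ring

/-- A continuous function on `E` which is periodic under the lattice spanned by `b` descends to
the torus. -/
theorem exists_continuousMap_torus {E : Type*} [NormedAddCommGroup E]
    [InnerProductSpace ℝ E] {ι : Type*} [Fintype ι] (b : Basis ι ℝ E) (f : E → ℂ) (hf : Continuous f)
    (hper : ∀ x, ∀ v ∈ Submodule.span ℤ (Set.range b), f (x + v) = f x) :
    ∃ F : C(UnitAddTorus ι, ℂ), ∀ θ : ι → ℝ,
      F (fun i => (θ i : UnitAddCircle)) = f (b.equivFun.symm θ) := by
  set F : UnitAddTorus ι → ℂ := fun x =>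
    f (b.equivFun.symm fun i => (AddCircle.equivIco 1 0 (x i) : ℝ))
  have hF : ∀ θ : ι → ℝ, F (fun i => (θ i : UnitAddCircle)) = f (b.equivFun.symm θ) := by
    intro θ
    have h : ∀ i, ∃ m : ℤ, (AddCircle.equivIco 1 0 (θ i : UnitAddCircle) : ℝ) = θ i + m := by
      intro i
      refine ⟨-toIcoDiv (zero_lt_one' ℝ) 0 (θ i), ?_⟩
      rw [AddCircle.coe_equivIco_mk_apply]
      have h := toIcoMod_add_toIcoDiv_zsmul (zero_lt_one' ℝ) 0 (θ i)
      have h1 : toIcoMod (zero_lt_one' ℝ) 0 (θ i) = Int.fract (θ i / 1) * 1 := by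
        rw [toIcoMod_eq_fract_mul]
      rw [← h1]
      simp only [zsmul_eq_mul, mul_one] at h
      push_cast
      linarith
    choose m hm using h
    have h1 : (b.equivFun.symm fun i => (AddCircle.equivIco 1 0 (θ i : UnitAddCircle) : ℝ)) =
        b.equivFun.symm θ + ∑ i, m i • b i := by
      simp only [hm, Basis.equivFun_symm_apply, add_smul, Finset.sum_add_distrib,
        Int.cast_smul_eq_zsmul]
    change f (b.equivFun.symm fun i => (AddCircle.equivIco 1 0 (θ i : UnitAddCircle) : ℝ)) = _
    rw [h1]
    exact hper _ _ (Submodule.sum_mem _ fun i _ =>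
      Submodule.smul_mem _ _ (Submodule.subset_span ⟨i, rfl⟩))
  refine ⟨⟨F, ?_⟩, hF⟩
  -- Continuity can be tested after pulling back along the quotient map from ℝ^ι to the torus.
  have hq : IsOpenQuotientMap (Pi.map fun (_ : ι) (t : ℝ) => (t : UnitAddCircle)) :=
    IsOpenQuotientMap.piMap fun _ => QuotientAddGroup.isOpenQuotientMap_mk
  rw [hq.isQuotientMap.continuous_iff]
  have : F ∘ (Pi.map fun (_ : ι) (t : ℝ) => (t : UnitAddCircle)) =
      fun θ => f (b.equivFun.symm θ) := funext hF
  rw [this]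
  exact hf.comp (LinearMap.continuous_of_finiteDimensional b.equivFun.symm.toLinearMap)

section Poisson

variable {E : Type*} [NormedAddCommGroup E] [InnerProductSpace ℝ E] [FiniteDimensional ℝ E]
  [MeasurableSpace E] [BorelSpace E] {ι : Type*} [Fintype ι]

/-- **Poisson summation** for Gaussians on a lattice with dual basis `w`. -/
theorem exists_hasSum_periodicGaussian (b : Basis ι ℝ E) (w : ι → E)
    (hw : ∀ i x, inner ℝ (w i) x = b.repr x i) :
    ∃ c : ℝ, 0 < c ∧ ∀ a : ℝ, 0 < a →
      Summable (fun k : ι → ℤ => Real.exp (-Real.pi ^ 2 * ‖∑ i, k i • w i‖ ^ 2 / a)) →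
      ∀ x : E, HasSum (fun k : ι → ℤ =>
        ((c * ((Real.pi / a) ^ ((finrank ℝ E : ℝ) / 2) *
          Real.exp (-Real.pi ^ 2 * ‖∑ i, k i • w i‖ ^ 2 / a)) : ℝ) : ℂ) *
          Complex.exp (((2 * Real.pi * inner ℝ (∑ i, k i • w i) x : ℝ) : ℂ) * Complex.I))
        (periodicGaussian (Submodule.span ℤ (Set.range b)) a x : ℂ) := by
  obtain ⟨c, hc, hcube⟩ := exists_setIntegral_cube_eq b
  refine ⟨c, hc, fun a ha hsum x => ?_⟩
  set L := Submodule.span ℤ (Set.range b)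
  obtain ⟨F, hF⟩ := exists_continuousMap_torus b (fun x => (periodicGaussian L a x : ℂ))
    (Complex.continuous_ofReal.comp (continuous_periodicGaussian L ha))
    (fun x v hv => by rw [periodicGaussian_add L a x hv])
  have hinner : ∀ (k : ι → ℤ) (y : E),
      inner ℝ (∑ i, k i • w i) y = ∑ i, k i * b.repr y i := by
    intro k y
    rw [sum_inner]
    refine Finset.sum_congr rfl fun i _ => ?_
    rw [← Int.cast_smul_eq_zsmul ℝ, real_inner_smul_left, hw]
  have hlat : ∀ (k : ι → ℤ), ∀ v ∈ L, ∃ m : ℤ, inner ℝ (∑ i, k i • w i) v = m := by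
    intro k v hv
    obtain ⟨p, rfl⟩ := (Submodule.mem_span_range_iff_exists_fun ℤ).1 hv
    refine ⟨∑ i, k i * p i, ?_⟩
    rw [hinner]
    push_cast
    refine Finset.sum_congr rfl fun i _ => ?_
    have h : b.repr (∑ j, p j • b j) i = p i := by
      have := congrFun (b.equivFun.apply_symm_apply (fun j => (p j : ℝ))) i
      rw [Basis.equivFun_symm_apply] at this
      simp only [Int.cast_smul_eq_zsmul] at this
      exact this
    rw [h]
  -- After unfolding, the k-th coefficient is the Fourier transform of a single Gaussian at the dual
  -- vector indexed by k.
  have hcoef : ∀ k : ι → ℤ, UnitAddTorus.mFourierCoeff F k =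
      ((c * ((Real.pi / a) ^ ((finrank ℝ E : ℝ) / 2) *
          Real.exp (-Real.pi ^ 2 * ‖∑ i, k i • w i‖ ^ 2 / a)) : ℝ) : ℂ) := by
    intro k
    set W := ∑ i, k i • w i
    set χ : E → ℂ := fun y =>
      Complex.exp (((-2 * Real.pi * inner ℝ y W : ℝ) : ℂ) * Complex.I) with hχ
    have h1 : UnitAddTorus.mFourierCoeff F k =
        c * ∫ y in ZSpan.fundamentalDomain b, χ y * periodicGaussian L a y := by
      rw [UnitAddTorus.mFourierCoeff_eq_integral F k 0,
        ← hcube fun y => χ y * periodicGaussian L a y]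
      refine integral_congr_ae (Filter.Eventually.of_forall fun θ => ?_)
      simp only [smul_eq_mul]
      rw [hF, mFourier_coe_apply, hχ]
      simp only
      rw [real_inner_comm, hinner]
      have : ∀ i, b.repr (b.equivFun.symm θ) i = θ i := fun i =>
        congrFun (b.equivFun.apply_symm_apply θ) i
      simp only [this]
      congr 4
      simp
    have h2 := setIntegral_periodicGaussian_mul b ha χ (by fun_prop)
      (fun y => Complex.norm_exp_ofReal_mul_I _) (by
        intro y v hv
        obtain ⟨m, hm⟩ := hlat k v hv
        rw [hχ]
        simp only
        rw [inner_add_left, real_inner_comm W v, hm, Complex.exp_eq_exp_iff_exists_int]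
        refine ⟨-m, ?_⟩
        push_cast
        ring)
    have h3 := fourier_gaussian_innerProductSpace (b := (a : ℂ)) (V := E) (by simpa using ha) W
    rw [Real.fourier_eq'] at h3
    rw [h1, h2]
    have h4 : ∫ y, χ y * (Real.exp (-a * ‖y‖ ^ 2) : ℂ) =
        (Real.pi / a : ℂ) ^ ((finrank ℝ E : ℂ) / 2) *
          Complex.exp (-Real.pi ^ 2 * ‖W‖ ^ 2 / a) := by
      rw [← h3]
      refine integral_congr_ae (Filter.Eventually.of_forall fun y => ?_)
      simp only [smul_eq_mul, hχ]
      push_cast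
      rfl
    rw [h4]
    push_cast
    rw [Complex.ofReal_cpow (by positivity)]
    push_cast
    rfl
  have hS : Summable (UnitAddTorus.mFourierCoeff F) := by
    have : UnitAddTorus.mFourierCoeff F = fun k => ((c * ((Real.pi / a) ^ ((finrank ℝ E : ℝ) / 2) *
          Real.exp (-Real.pi ^ 2 * ‖∑ i, k i • w i‖ ^ 2 / a)) : ℝ) : ℂ) := funext hcoef
    rw [this]
    exact Complex.ofRealCLM.summable ((hsum.mul_left _).mul_left _)
  have hfin := UnitAddTorus.hasSum_mFourier_series_apply_of_summable hS
    (fun i => (b.repr x i : UnitAddCircle))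
  rw [hF] at hfin
  have hx : b.equivFun.symm (fun i => b.repr x i) = x := b.equivFun.symm_apply_apply x
  rw [hx] at hfin
  convert hfin using 2 with k
  rw [hcoef, mFourier_coe_apply, smul_eq_mul, hinner]

/-! ### Covering radius against smoothing parameter. -/

/-- The term at `i₀` is the main term c; all the others together have modulus at most c (S - 1).
With S ≤ 3/2 this pins T between c/2 and 3c/2. -/
theorem abs_sub_le_of_hasSum_mul {ι : Type*} {c S T : ℝ} {u : ι → ℝ} {z : ι → ℂ} {i₀ : ι}
    (hc : 0 < c) (hu : ∀ i, 0 ≤ u i) (hz : ∀ i, ‖z i‖ = 1) (hu0 : u i₀ = 1) (hz0 : z i₀ = 1)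
    (hS : HasSum u S) (hT : HasSum (fun i => ((c * u i : ℝ) : ℂ) * z i) (T : ℂ)) :
    |T - c| ≤ c * (S - 1) := by
  classical
  have h1 := hT.update i₀ 0
  have h2 := (hS.update i₀ 0).mul_left c
  rw [hu0] at h2
  rw [hu0, hz0] at h1
  have h3 := tsum_of_norm_bounded h2 (f := Function.update
    (fun i => ((c * u i : ℝ) : ℂ) * z i) i₀ 0) fun i => ?_
  · rw [h1.tsum_eq] at h3
    have h4 : (0 - ((c * 1 : ℝ) : ℂ) * 1 + (T : ℂ)) = ((T - c : ℝ) : ℂ) := by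
      push_cast; ring
    rw [h4, Complex.norm_real, Real.norm_eq_abs] at h3
    linarith
  · by_cases hi : i = i₀
    · subst hi
      simp
    · simp [hi, hz, abs_of_pos hc, abs_of_nonneg (hu i)]

/-- If the dual Gaussian sum at `s` is at most `3/2`, every point is within `s √d` of the
lattice. -/
theorem exists_mem_norm_add_le (b : Basis ι ℝ E) (w : ι → E)
    (hw : ∀ i x, inner ℝ (w i) x = b.repr x i) {s S : ℝ} (hs : 0 < s) (hS : S ≤ 3 / 2)
    (hsum : HasSum (fun k : ι → ℤ =>
      Real.exp (-Real.pi * ‖s • ∑ i, k i • w i‖ ^ 2)) S) (x : E) :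
    ∃ v ∈ Submodule.span ℤ (Set.range b), ‖v + x‖ ≤ Real.sqrt (finrank ℝ E) * s := by
  set d := finrank ℝ E
  set L := Submodule.span ℤ (Set.range b)
  rcases Nat.eq_zero_or_pos d with hd | hd
  · have : Subsingleton E := finrank_zero_iff.1 hd
    exact ⟨0, L.zero_mem, by simp [Subsingleton.elim x 0, hd]⟩
  -- The periodic Gaussian at x is compared for the parameters a = π/s² and a/4: Poisson summation
  -- makes both nearly constant in x, whereas remoteness of the lattice would make the first far
  -- smaller than the second.
  by_contra! hfar
  obtain ⟨c, hc, hP⟩ := exists_hasSum_periodicGaussian b w hw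
  set a := Real.pi / s ^ 2 with ha
  have hpi := Real.pi_pos
  have ha0 : 0 < a := by positivity
  -- Lowering a' shrinks every dual term, so the bound on the dual sum at a holds for all a' ≤ a.
  have hbound : ∀ a' : ℝ, 0 < a' → a' ≤ a →
      |periodicGaussian L a' x - c * (Real.pi / a') ^ ((d : ℝ) / 2)| ≤
        c * (Real.pi / a') ^ ((d : ℝ) / 2) * (1 / 2) := by
    intro a' ha' haa
    have hle : ∀ k : ι → ℤ, Real.exp (-Real.pi ^ 2 * ‖∑ i, k i • w i‖ ^ 2 / a') ≤
        Real.exp (-Real.pi * ‖s • ∑ i, k i • w i‖ ^ 2) := by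
      intro k
      rw [Real.exp_le_exp, norm_smul, mul_pow, Real.norm_of_nonneg hs.le, div_le_iff₀ ha']
      have h1 : Real.pi = a * s ^ 2 := by rw [ha]; field_simp
      have h2 : a' * s ^ 2 ≤ Real.pi := by rw [h1]; gcongr
      have h3 : 0 ≤ Real.pi * ‖∑ i, k i • w i‖ ^ 2 := by positivity
      nlinarith
    have hs' : Summable fun k : ι → ℤ => Real.exp (-Real.pi ^ 2 * ‖∑ i, k i • w i‖ ^ 2 / a') :=
      hsum.summable.of_nonneg_of_le (fun _ => Real.exp_nonneg _) hle
    have h1 := hP a' ha' hs' x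
    simp only [← mul_assoc] at h1
    have h2 := abs_sub_le_of_hasSum_mul (i₀ := 0) (by positivity) (fun k => Real.exp_nonneg _)
      (fun k => Complex.norm_exp_ofReal_mul_I _) (by simp) (by simp) hs'.hasSum h1
    refine h2.trans ?_
    have h3 := (hasSum_le hle hs'.hasSum hsum).trans hS
    gcongr
    linarith
  have h1 := (abs_le.1 (hbound a ha0 le_rfl)).1
  have h2 := (abs_le.1 (hbound (a / 4) (by positivity) (by linarith))).2
  set C := c * (Real.pi / a) ^ ((d : ℝ) / 2) with hC
  have hC0 : 0 < C := by positivity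
  have h4 : c * (Real.pi / (a / 4)) ^ ((d : ℝ) / 2) = 2 ^ d * C := by
    have h5 : Real.pi / (a / 4) = 2 ^ (2 : ℝ) * (Real.pi / a) := by
      norm_num
      field_simp
    rw [h5, Real.mul_rpow (by positivity) (by positivity), ← Real.rpow_mul (by norm_num),
      mul_div_cancel₀ _ two_ne_zero, Real.rpow_natCast, hC]
    ring
  rw [h4] at h2
  -- The constant is 6 = 3 · 2: widening the Gaussian multiplies its mass by 2^d, and the Poisson
  -- bounds 3/2 and 1/2 have ratio 3 ≤ 3^d.
  have hexp : (6 : ℝ) ^ d < Real.exp (3 * Real.pi / 4 * d) := by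
    rw [mul_comm, Real.exp_nat_mul]
    refine pow_lt_pow_left₀ ?_ (by norm_num) hd.ne'
    have h6 : Real.exp 2 < Real.exp (3 * Real.pi / 4) := by
      rw [Real.exp_lt_exp]
      linarith [Real.pi_gt_three]
    refine lt_of_le_of_lt ?_ h6
    have h7 : Real.exp 2 = Real.exp 1 * Real.exp 1 := by rw [← Real.exp_add]; norm_num
    rw [h7]
    nlinarith [Real.exp_one_gt_d9]
  -- Each term is split as exp(-3ar²/4) · exp(-ar²/4), where r ≥ √d · s gives a r² ≥ πd.
  have h8 : periodicGaussian L a x ≤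
      Real.exp (-(3 * Real.pi / 4 * d)) * periodicGaussian L (a / 4) x := by
    unfold periodicGaussian
    rw [← tsum_mul_left]
    refine (summable_exp_neg_mul_norm_add_sq L ha0 x).tsum_le_tsum (fun v => ?_)
      ((summable_exp_neg_mul_norm_add_sq L (by positivity) x).mul_left _)
    rw [← Real.exp_add, Real.exp_le_exp]
    have h9 : (Real.sqrt d * s) ^ 2 ≤ ‖(v : E) + x‖ ^ 2 := by
      have := (hfar v v.2).le
      gcongr
    rw [mul_pow, Real.sq_sqrt (Nat.cast_nonneg d)] at h9
    have h10 : Real.pi = a * s ^ 2 := by rw [ha]; field_simp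
    have h11 : a * (d * s ^ 2) ≤ a * ‖(v : E) + x‖ ^ 2 := by gcongr
    have h12 : Real.pi * d = a * (d * s ^ 2) := by rw [h10]; ring
    linarith
  rw [Real.exp_neg] at h8
  have h9 : periodicGaussian L a x * Real.exp (3 * Real.pi / 4 * d) ≤
      periodicGaussian L (a / 4) x := by
    rwa [← div_eq_inv_mul, le_div_iff₀ (Real.exp_pos _)] at h8
  have h10 : C / 2 * 6 ^ d < periodicGaussian L a x * Real.exp (3 * Real.pi / 4 * d) := by
    have : C / 2 ≤ periodicGaussian L a x := by linarith
    exact mul_lt_mul' this hexp (by positivity) (by linarith)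
  have h11 : (3 : ℝ) * 2 ^ d ≤ 6 ^ d := by
    have : (6 : ℝ) ^ d = 3 ^ d * 2 ^ d := by rw [← mul_pow]; norm_num
    rw [this]
    gcongr
    calc (3 : ℝ) = 3 ^ 1 := by norm_num
      _ ≤ 3 ^ d := pow_le_pow_right₀ (by norm_num) hd
  nlinarith

end Poisson

/-! ### Bases, dual lattices, sublattices and lattice subspaces. -/

variable {n : ℕ}

/-- The real span of a lattice. -/
abbrev realSpan (L : Submodule ℤ (Space n)) : Submodule ℝ (Space n) :=
  Submodule.span ℝ (L : Set (Space n))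

theorem IsBasis.span_eq {d : ℕ} {L : Submodule ℤ (Space n)} {b : Fin d → Space n}
    (hb : IsBasis L b) : Submodule.span ℝ (Set.range b) = realSpan L := by
  rw [realSpan, ← hb.2, Submodule.span_span_of_tower]

theorem IsBasis.mem {d : ℕ} {L : Submodule ℤ (Space n)} {b : Fin d → Space n}
    (hb : IsBasis L b) (i : Fin d) : b i ∈ L := by
  rw [← hb.2]
  exact Submodule.subset_span ⟨i, rfl⟩

theorem IsBasis.finrank_eq {d : ℕ} {L : Submodule ℤ (Space n)} {b : Fin d → Space n}
    (hb : IsBasis L b) : finrank ℝ (realSpan L) = d := by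
  rw [← hb.span_eq, finrank_span_eq_card hb.1, Fintype.card_fin]

theorem eq_zero_of_mem_span_of_inner_eq_zero {ι : Type*} {b : ι → Space n} {z : Space n}
    (hz : z ∈ Submodule.span ℝ (Set.range b)) (h : ∀ i, inner ℝ z (b i) = 0) : z = 0 := by
  have h1 : Submodule.span ℝ (Set.range b) ≤ (ℝ ∙ z)ᗮ := by
    rw [Submodule.span_le]
    rintro _ ⟨i, rfl⟩
    exact Submodule.mem_orthogonal_singleton_iff_inner_right.2 (h i)
  exact inner_self_eq_zero.1 (Submodule.mem_orthogonal_singleton_iff_inner_right.1 (h1 hz))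

/-- The w i are the Riesz representatives of the coordinate functionals on the span. -/
theorem exists_biorthogonal {d : ℕ} {b : Fin d → Space n} (hb : LinearIndependent ℝ b) :
    ∃ w : Fin d → Space n, (∀ i, w i ∈ Submodule.span ℝ (Set.range b)) ∧
      ∀ i j, inner ℝ (w i) (b j) = if i = j then 1 else 0 := by
  set B := Basis.span hb
  refine ⟨fun i => ((InnerProductSpace.toDual ℝ _).symm
    (LinearMap.toContinuousLinearMap (B.coord i)) : Submodule.span ℝ (Set.range b)),
    fun i => Submodule.coe_mem _, fun i j => ?_⟩
  have h1 : b j = (B j : Space n) := by rw [Basis.span_apply]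
  rw [h1, ← Submodule.coe_inner, InnerProductSpace.toDual_symm_apply]
  simp [Finsupp.single_apply, eq_comm]

theorem inner_sum_zsmul {d : ℕ} {b w : Fin d → Space n}
    (h : ∀ i j, inner ℝ (w i) (b j) = if i = j then (1 : ℝ) else 0) (p : Fin d → ℤ) (j : Fin d) :
    inner ℝ (∑ i, p i • w i) (b j) = (p j : ℝ) := by
  simp only [sum_inner, ← Int.cast_smul_eq_zsmul ℝ, real_inner_smul_left, h]
  simp

theorem linearIndependent_of_biorthogonal {d : ℕ} {b w : Fin d → Space n}
    (h : ∀ i j, inner ℝ (w i) (b j) = if i = j then (1 : ℝ) else 0) : LinearIndependent ℝ w := by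
  rw [Fintype.linearIndependent_iff]
  intro g hg j
  have h1 : inner ℝ (∑ i, g i • w i) (b j) = (0 : ℝ) := by rw [hg, inner_zero_left]
  simpa only [sum_inner, real_inner_smul_left, h, mul_ite, mul_one, mul_zero, Finset.sum_ite_eq',
    Finset.mem_univ, if_true] using h1

theorem IsBasis.dual_of_biorthogonal {d : ℕ} {L : Submodule ℤ (Space n)} {b w : Fin d → Space n}
    (hb : IsBasis L b) (hw : ∀ i, w i ∈ realSpan L)
    (h : ∀ i j, inner ℝ (w i) (b j) = if i = j then (1 : ℝ) else 0) : IsBasis (dual L) w := by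
  refine ⟨linearIndependent_of_biorthogonal h, le_antisymm ?_ ?_⟩
  · rw [Submodule.span_le]
    rintro _ ⟨i, rfl⟩
    refine ⟨hw i, fun x hx => ?_⟩
    rw [← hb.2] at hx
    obtain ⟨p, rfl⟩ := (Submodule.mem_span_range_iff_exists_fun ℤ).1 hx
    refine ⟨p i, ?_⟩
    rw [real_inner_comm]
    exact inner_sum_zsmul (fun k l => by rw [real_inner_comm, h l k]; simp [eq_comm]) p i
  · rintro y ⟨hy, hy'⟩
    choose p hp using fun i => hy' (b i) (hb.mem i)
    refine (Submodule.mem_span_range_iff_exists_fun ℤ).2 ⟨p, ?_⟩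
    have hsum : ∑ i, p i • w i ∈ realSpan L := Submodule.sum_mem _ fun i _ => by
      rw [← Int.cast_smul_eq_zsmul ℝ]
      exact Submodule.smul_mem _ _ (hw i)
    rw [← sub_eq_zero]
    refine eq_zero_of_mem_span_of_inner_eq_zero (b := b) ?_ fun i => ?_
    · rw [hb.span_eq]
      exact Submodule.sub_mem _ hsum hy
    · rw [inner_sub_left, inner_sum_zsmul h, hp, sub_self]

theorem IsBasis.exists_dual {d : ℕ} {L : Submodule ℤ (Space n)} {b : Fin d → Space n}
    (hb : IsBasis L b) : ∃ w : Fin d → Space n, IsBasis (dual L) w ∧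
      ∀ i j, inner ℝ (w i) (b j) = if i = j then (1 : ℝ) else 0 := by
  obtain ⟨w, hw, h⟩ := exists_biorthogonal hb.1
  exact ⟨w, hb.dual_of_biorthogonal (fun i => hb.span_eq ▸ hw i) h, h⟩

theorem IsLattice.dual {L : Submodule ℤ (Space n)} (hL : IsLattice L) : IsLattice (dual L) := by
  obtain ⟨d, b, hb⟩ := hL
  obtain ⟨w, hw, -⟩ := hb.exists_dual
  exact ⟨d, w, hw⟩

theorem realSpan_dual {L : Submodule ℤ (Space n)} (hL : IsLattice L) :
    realSpan (EuclideanLattice.dual L) = realSpan L := by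
  obtain ⟨d, b, hb⟩ := hL
  obtain ⟨w, hw, -⟩ := hb.exists_dual
  refine Submodule.eq_of_le_of_finrank_eq ?_ (hw.finrank_eq.trans hb.finrank_eq.symm)
  exact Submodule.span_le.2 fun y hy => hy.1

theorem dual_dual {L : Submodule ℤ (Space n)} (hL : IsLattice L) :
    EuclideanLattice.dual (EuclideanLattice.dual L) = L := by
  have hs := realSpan_dual hL
  obtain ⟨d, b, hb⟩ := hL
  obtain ⟨w, hw, h⟩ := hb.exists_dual
  have h2 : IsBasis (EuclideanLattice.dual (EuclideanLattice.dual L)) b :=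
    hw.dual_of_biorthogonal (fun i => hs ▸ Submodule.subset_span (hb.mem i))
      fun i j => by rw [real_inner_comm, h j i]; simp [eq_comm]
  rw [← h2.2, hb.2]

/-- A finitely generated subgroup whose rank is at most the dimension of its span is a lattice. -/
theorem isLattice_of_finrank_le (N : Submodule ℤ (Space n)) [Module.Finite ℤ N]
    (h : finrank ℤ N ≤ finrank ℝ (realSpan N)) : IsLattice N := by
  have : Module.IsTorsionFree ℤ (Space n) := .trans_faithfulSMul ℤ ℝ _
  set c := finBasis ℤ N
  have hspan : Submodule.span ℤ (Set.range fun i => (c i : Space n)) = N := by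
    have h1 : (Set.range fun i => (c i : Space n)) = N.subtype '' Set.range c := by
      rw [← Set.range_comp]
      rfl
    rw [h1, ← Submodule.map_span, c.span_eq, Submodule.map_top, Submodule.range_subtype]
  refine ⟨_, fun i => (c i : Space n), ?_, hspan⟩
  -- A spanning family with no more members than the dimension of its span is independent.
  rw [linearIndependent_iff_card_le_finrank_span, Fintype.card_fin]
  rw [Set.finrank, ← Submodule.span_span_of_tower ℤ ℝ, hspan]
  exact h

theorem IsLattice.discreteTopology {L : Submodule ℤ (Space n)} (hL : IsLattice L) :
    DiscreteTopology L := by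
  obtain ⟨d, b, hb⟩ := hL
  have hli := hb.1.linearIndepOn_id
  set B := Basis.extend hli
  have hB : Set.range b ⊆ Set.range B := by
    rw [Basis.range_extend]
    exact Basis.subset_extend hli
  have hfin : Finite (hli.extend (Set.subset_univ _)) := Module.Finite.finite_basis B
  have h1 : DiscreteTopology (Submodule.span ℤ (Set.range B)) := inferInstance
  refine DiscreteTopology.of_subset (s := (Submodule.span ℤ (Set.range B) : Set (Space n))) h1 ?_
  rw [← hb.2]
  exact Submodule.span_mono hB

/-- Discreteness passes to subgroups, and a discrete subgroup has integer rank equal to the real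
dimension of its span. -/
theorem IsLattice.mono {L L' : Submodule ℤ (Space n)} (hL : IsLattice L) (h : L' ≤ L) :
    IsLattice L' := by
  have := hL.discreteTopology
  have h1 : DiscreteTopology L' :=
    DiscreteTopology.of_subset (s := (L : Set (Space n))) this h
  have h2 := Real.finrank_eq_int_finrank_of_discrete (s := (L' : Set (Space n)))
    (by rwa [Submodule.span_eq])
  rw [Set.finrank, Set.finrank, Submodule.span_eq] at h2
  exact isLattice_of_finrank_le L' h2.ge

theorem IsLattice.finrank_eq {L : Submodule ℤ (Space n)} (hL : IsLattice L) :
    finrank ℤ L = finrank ℝ (realSpan L) := by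
  have := hL.discreteTopology
  have h2 := Real.finrank_eq_int_finrank_of_discrete (s := (L : Set (Space n)))
    (by rwa [Submodule.span_eq])
  rw [Set.finrank, Set.finrank, Submodule.span_eq] at h2
  exact h2.symm

theorem IsLattice.inter {L : Submodule ℤ (Space n)} (hL : IsLattice L)
    (W : Submodule ℝ (Space n)) : IsLattice (inter L W) :=
  hL.mono inf_le_left

theorem isLatticeSubspace_iff {M : Submodule ℤ (Space n)} {W : Submodule ℝ (Space n)} :
    IsLatticeSubspace M W ↔ realSpan (EuclideanLattice.inter M W) = W := by
  constructor
  · rintro ⟨b, hb⟩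
    refine le_antisymm (Submodule.span_le.2 fun x hx => hx.2) ?_
    have h1 : W = Submodule.map W.subtype (Submodule.span ℝ (Set.range b)) := by
      rw [b.span_eq, Submodule.map_top, Submodule.range_subtype]
    conv_lhs => rw [h1]
    rw [Submodule.map_span, Submodule.span_le]
    rintro _ ⟨_, ⟨i, rfl⟩, rfl⟩
    exact Submodule.subset_span ⟨hb i, (b i).2⟩
  · intro h
    obtain ⟨t, ht, hspan, hli⟩ := exists_linearIndependent ℝ
      (EuclideanLattice.inter M W : Set (Space n))
    have hfin : Finite t := hli.finite
    have := Fintype.ofFinite t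
    have hW : Submodule.span ℝ (Set.range (Subtype.val : t → Space n)) = W := by
      rw [Subtype.range_coe, hspan]
      exact h
    have hcard : Fintype.card t = finrank ℝ W := by
      rw [← finrank_span_eq_card hli, hW]
    set e := Fintype.equivFinOfCardEq hcard
    set B : Basis t ℝ W := (Basis.span hli).map (LinearEquiv.ofEq _ _ hW)
    refine ⟨B.reindex e, fun i => ?_⟩
    have : ((B.reindex e) i : Space n) = e.symm i := by
      simp [B, Basis.span_apply]
    rw [this]
    exact (ht (e.symm i).2).1

/-! ### Projections, their duality with intersections, and composition of coverings. -/

/-- The orthogonal projection of a lattice to a subspace. -/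
def proj (L : Submodule ℤ (Space n)) (U : Submodule ℝ (Space n)) : Submodule ℤ (Space n) :=
  L.map (U.starProjection.toLinearMap.restrictScalars ℤ)

theorem mem_proj {L : Submodule ℤ (Space n)} {U : Submodule ℝ (Space n)} {y : Space n} :
    y ∈ proj L U ↔ ∃ x ∈ L, U.starProjection x = y := Iff.rfl

theorem realSpan_proj (L : Submodule ℤ (Space n)) (U : Submodule ℝ (Space n)) :
    realSpan (proj L U) = (realSpan L).map U.starProjection.toLinearMap := by
  rw [realSpan, realSpan, Submodule.map_span]
  rfl

theorem realSpan_proj_of_le {L : Submodule ℤ (Space n)} {W : Submodule ℝ (Space n)}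
    (hW : W ≤ realSpan L) : realSpan (proj L W) = W := by
  rw [realSpan_proj]
  refine le_antisymm ?_ fun x hx => ⟨x, hW hx, Submodule.starProjection_eq_self_iff.2 hx⟩
  rintro _ ⟨x, -, rfl⟩
  exact Submodule.starProjection_apply_mem W x

theorem starProjection_orthogonal_eq (W : Submodule ℝ (Space n)) (x : Space n) :
    Wᗮ.starProjection x = x - W.starProjection x := by
  rw [Submodule.starProjection_orthogonal_val]

theorem realSpan_proj_orthogonal {L : Submodule ℤ (Space n)} {W : Submodule ℝ (Space n)}
    (hW : W ≤ realSpan L) : realSpan (proj L Wᗮ) = Wᗮ ⊓ realSpan L := by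
  rw [realSpan_proj]
  refine le_antisymm ?_ fun x hx => ⟨x, hx.2, Submodule.starProjection_eq_self_iff.2 hx.1⟩
  rintro _ ⟨x, hx, rfl⟩
  refine ⟨Submodule.starProjection_apply_mem _ x, ?_⟩
  change Wᗮ.starProjection x ∈ realSpan L
  rw [starProjection_orthogonal_eq]
  exact Submodule.sub_mem _ hx (hW (Submodule.starProjection_apply_mem W x))

/-- For y in U, pairing with y does not see the projection to U. The hypothesis on the span holds
for U = W and for U = Wᗮ when W lies in the span of L. -/
theorem dual_proj {L : Submodule ℤ (Space n)} {U : Submodule ℝ (Space n)}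
    (hU : realSpan (proj L U) = U ⊓ realSpan L) :
    EuclideanLattice.dual (proj L U) = EuclideanLattice.inter (EuclideanLattice.dual L) U := by
  have key : ∀ y ∈ U, ∀ x, inner ℝ y (U.starProjection x) = (inner ℝ y x : ℝ) := fun y hy x => by
    rw [← Submodule.inner_starProjection_left_eq_right,
      Submodule.starProjection_eq_self_iff.2 hy]
  ext y
  constructor
  · rintro ⟨hy, hy'⟩
    replace hy : y ∈ U ⊓ realSpan L := hU ▸ hy
    refine ⟨⟨hy.2, fun x hx => ?_⟩, hy.1⟩
    obtain ⟨k, hk⟩ := hy' _ (mem_proj.2 ⟨x, hx, rfl⟩)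
    exact ⟨k, by rw [← key y hy.1, hk]⟩
  · rintro ⟨⟨hy, hy'⟩, hyU⟩
    refine ⟨hU.ge ⟨hyU, hy⟩, ?_⟩
    rintro _ ⟨x, hx, rfl⟩
    obtain ⟨k, hk⟩ := hy' x hx
    exact ⟨k, (key y hyU x).trans hk⟩

theorem finrank_realSpan_proj_orthogonal {M : Submodule ℤ (Space n)} {W : Submodule ℝ (Space n)}
    (hW : W ≤ realSpan M) :
    finrank ℝ W + finrank ℝ (realSpan (proj M Wᗮ)) = finrank ℝ (realSpan M) := by
  rw [realSpan_proj_orthogonal hW]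
  exact Submodule.finrank_add_inf_finrank_orthogonal hW

theorem IsLatticeSubspace.le {M : Submodule ℤ (Space n)} {W : Submodule ℝ (Space n)}
    (hW : IsLatticeSubspace M W) : W ≤ realSpan M := by
  rw [← isLatticeSubspace_iff.1 hW]
  exact Submodule.span_mono fun x hx => hx.1

theorem starProjection_orthogonal_eq_zero_iff {W : Submodule ℝ (Space n)} {x : Space n} :
    Wᗮ.starProjection x = 0 ↔ x ∈ W := by
  rw [starProjection_orthogonal_eq, sub_eq_zero, eq_comm, Submodule.starProjection_eq_self_iff]

/-- A projection of a lattice need not be discrete. Here the kernel M ∩ W has full rank dim W, so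
rank–nullity leaves the image with rank equal to the dimension of its span. -/
theorem IsLattice.proj_orthogonal {M : Submodule ℤ (Space n)} (hM : IsLattice M)
    {W : Submodule ℝ (Space n)} (hW : IsLatticeSubspace M W) : IsLattice (proj M Wᗮ) := by
  have hd := hM.discreteTopology
  set f : M →ₗ[ℤ] Space n :=
    (Wᗮ.starProjection.toLinearMap.restrictScalars ℤ).comp M.subtype with hf
  have hrange : LinearMap.range f = proj M Wᗮ := by
    rw [hf, LinearMap.range_comp, Submodule.range_subtype]
    rfl
  have hker : (LinearMap.ker f).map M.subtype = EuclideanLattice.inter M W := by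
    ext x
    constructor
    · rintro ⟨y, hy, rfl⟩
      exact ⟨y.2, starProjection_orthogonal_eq_zero_iff.1 hy⟩
    · rintro ⟨hx, hx'⟩
      exact ⟨⟨x, hx⟩, starProjection_orthogonal_eq_zero_iff.2 hx', rfl⟩
  have h1 : finrank ℤ (LinearMap.ker f) = finrank ℝ W := by
    rw [(Submodule.equivSubtypeMap M (LinearMap.ker f)).finrank_eq, hker,
      (hM.inter W).finrank_eq, isLatticeSubspace_iff.1 hW]
  have h2 := Submodule.finrank_quotient_add_finrank (LinearMap.ker f)
  rw [f.quotKerEquivRange.finrank_eq, h1, hM.finrank_eq, hrange] at h2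
  have h3 := finrank_realSpan_proj_orthogonal hW.le
  have : Module.Finite ℤ (proj M Wᗮ) := by
    rw [← hrange]
    infer_instance
  exact isLattice_of_finrank_le _ (by omega)

/-- `L` comes within distance `r` of every point of its span. -/
def Covers (L : Submodule ℤ (Space n)) (r : ℝ) : Prop :=
  ∀ x ∈ realSpan L, ∃ v ∈ L, ‖x - v‖ ≤ r

theorem coveringRadius_le {L : Submodule ℤ (Space n)} {r : ℝ} (hr : 0 ≤ r) (h : Covers L r) :
    coveringRadius L ≤ r :=
  csInf_le ⟨0, fun _ h => h.1⟩ ⟨hr, h⟩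

/-- Dualizing `dual_proj` does it, once the projection is known to be a lattice; that follows from
the easy inclusion into the dual of M ∩ W. -/
theorem dual_inter {M : Submodule ℤ (Space n)} (hM : IsLattice M) {W : Submodule ℝ (Space n)}
    (hW : IsLatticeSubspace M W) :
    EuclideanLattice.dual (EuclideanLattice.inter M W) = proj (EuclideanLattice.dual M) W := by
  have hle : W ≤ realSpan (EuclideanLattice.dual M) := realSpan_dual hM ▸ hW.le
  have h1 : EuclideanLattice.dual (proj (EuclideanLattice.dual M) W) =
      EuclideanLattice.inter M W := by
    rw [dual_proj, dual_dual hM]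
    rw [realSpan_proj_of_le hle, inf_eq_left.2 hle]
  have h2 : proj (EuclideanLattice.dual M) W ≤
      EuclideanLattice.dual (EuclideanLattice.inter M W) := by
    rintro _ ⟨x, hx, rfl⟩
    refine ⟨?_, fun y hy => ?_⟩
    · change W.starProjection x ∈ realSpan (EuclideanLattice.inter M W)
      rw [isLatticeSubspace_iff.1 hW]
      exact Submodule.starProjection_apply_mem W x
    · obtain ⟨k, hk⟩ := hx.2 y hy.1
      refine ⟨k, ?_⟩
      change inner ℝ (W.starProjection x) y = (k : ℝ)
      rw [Submodule.inner_starProjection_left_eq_right,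
        Submodule.starProjection_eq_self_iff.2 hy.2, hk]
  rw [← h1, dual_dual ((hM.inter W).dual.mono h2)]

theorem dual_proj_orthogonal {M : Submodule ℤ (Space n)} {W : Submodule ℝ (Space n)}
    (hW : IsLatticeSubspace M W) :
    EuclideanLattice.dual (proj M Wᗮ) =
      EuclideanLattice.inter (EuclideanLattice.dual M) Wᗮ :=
  dual_proj (realSpan_proj_orthogonal hW.le)

/-- Rounding in two stages: the W-component is approximated by a projected vector, which is lifted
to v; the Wᗮ-component of x - v is then corrected by a vector orthogonal to W, leaving the first
error unchanged. Pythagoras combines the errors. -/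
theorem Covers.dual {M : Submodule ℤ (Space n)} (hM : IsLattice M) {W : Submodule ℝ (Space n)}
    (hW : IsLatticeSubspace M W) {r₁ r₂ : ℝ}
    (h₁ : Covers (EuclideanLattice.dual (EuclideanLattice.inter M W)) r₁)
    (h₂ : Covers (EuclideanLattice.dual (proj M Wᗮ)) r₂) :
    Covers (EuclideanLattice.dual M) (Real.sqrt (r₁ ^ 2 + r₂ ^ 2)) := by
  intro x hx
  have hle : W ≤ realSpan (EuclideanLattice.dual M) := realSpan_dual hM ▸ hW.le
  obtain ⟨_, hv, hv'⟩ := h₁ (W.starProjection x) (by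
    rw [dual_inter hM hW, realSpan_proj_of_le hle]
    exact Submodule.starProjection_apply_mem W x)
  rw [dual_inter hM hW] at hv
  obtain ⟨v, hvM, rfl⟩ := mem_proj.1 hv
  obtain ⟨u, hu, hu'⟩ := h₂ (Wᗮ.starProjection (x - v)) (by
    rw [realSpan_dual (hM.proj_orthogonal hW), realSpan_proj, ← realSpan_dual hM]
    exact ⟨x - v, Submodule.sub_mem _ hx (Submodule.subset_span hvM), rfl⟩)
  rw [dual_proj_orthogonal hW] at hu
  refine ⟨v + u, Submodule.add_mem _ hvM hu.1, ?_⟩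
  apply Real.le_sqrt_of_sq_le
  rw [Submodule.norm_sq_eq_add_norm_sq_starProjection _ W]
  have h3 : W.starProjection (x - (v + u)) = W.starProjection x - W.starProjection v := by
    have h4 : W.starProjection u = 0 :=
      (Submodule.starProjection_apply_eq_zero_iff W).2 hu.2
    rw [map_sub, map_add, h4, add_zero]
  have h4 : Wᗮ.starProjection (x - (v + u)) = Wᗮ.starProjection (x - v) - u := by
    rw [← sub_sub, map_sub, Submodule.starProjection_eq_self_iff.2 hu.2]
  rw [h3, h4]
  gcongr

/-! ### Multiplicativity of determinants. -/

theorem gramVolume_eq {d : ℕ} (b : Fin d → Space n) :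
    gramVolume b = Real.sqrt (Matrix.gram ℝ b).det := rfl

theorem gramVolume_pos {d : ℕ} {b : Fin d → Space n} (hb : LinearIndependent ℝ b) :
    0 < gramVolume b :=
  Real.sqrt_pos.2 (Matrix.posDef_gram_of_linearIndependent (𝕜 := ℝ) hb).det_pos

theorem det_pos {L : Submodule ℤ (Space n)} (hL : IsLattice L) : 0 < det L := by
  obtain ⟨d, b, hb⟩ := hL
  rw [det_eq_gramVolume hb]
  exact gramVolume_pos hb.1

/-- Gram volumes are multiplicative along orthogonal projections. -/
theorem gramVolume_append {d e : ℕ} (c : Fin d → Space n) (u v : Fin e → Space n)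
    (hcu : ∀ i j, inner ℝ (c i) (u j) = (0 : ℝ))
    (hv : ∀ j, v j - u j ∈ Submodule.span ℝ (Set.range c)) :
    gramVolume (Fin.append c v) = gramVolume c * gramVolume u := by
  choose A hA using fun j => (Submodule.mem_span_range_iff_exists_fun ℝ).1 (hv j)
  replace hA : ∀ j, v j = ∑ i, A j i • c i + u j := fun j => by rw [hA j]; abel
  have huc : ∀ j i, inner ℝ (u j) (c i) = (0 : ℝ) := fun j i => by rw [real_inner_comm, hcu]
  have hc1 : ∀ i j, inner ℝ (c i) (v j) = ∑ k, inner ℝ (c i) (c k) * A j k := fun i j => by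
    rw [hA j, inner_add_right, hcu, add_zero, inner_sum]
    exact Finset.sum_congr rfl fun k _ => by rw [real_inner_smul_right, mul_comm]
  have hc2 : ∀ i j, inner ℝ (v j) (c i) = ∑ k, A j k * inner ℝ (c k) (c i) := fun i j => by
    rw [hA j, inner_add_left, huc, add_zero, sum_inner]
    exact Finset.sum_congr rfl fun k _ => by rw [real_inner_smul_left]
  -- Passing from (c, u) to (c, v) is a block unitriangular change of vectors, and the Gram matrix
  -- of (c, u) is block diagonal.
  set T : Matrix (Fin d ⊕ Fin e) (Fin d ⊕ Fin e) ℝ := Matrix.fromBlocks 1 0 (Matrix.of A) 1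
  have hgram : (Matrix.gram ℝ (Fin.append c v)).submatrix finSumFinEquiv finSumFinEquiv =
      T * Matrix.fromBlocks (Matrix.gram ℝ c) 0 0 (Matrix.gram ℝ u) * T.transpose := by
    rw [Matrix.fromBlocks_transpose, Matrix.fromBlocks_multiply, Matrix.fromBlocks_multiply]
    ext i j
    rcases i with i | i <;> rcases j with j | j
    · simp [Matrix.gram_apply]
    · simp [Matrix.gram_apply, hc1, Matrix.mul_apply]
    · simp [Matrix.gram_apply, hc2, Matrix.mul_apply]
    · have h1 : inner ℝ (v i) (v j) = (∑ x, (∑ y, A i y * inner ℝ (c y) (c x)) * A j x) +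
          inner ℝ (u i) (u j) := by
        conv_lhs => rw [hA j]
        rw [inner_add_right, inner_sum]
        congr 1
        · exact Finset.sum_congr rfl fun k _ => by rw [real_inner_smul_right, hc2, mul_comm]
        · rw [hA i, inner_add_left, sum_inner]
          simp [real_inner_smul_left, hcu]
      simp [Matrix.gram_apply, h1, Matrix.mul_apply]
  have hT : T.det = 1 := by
    rw [Matrix.det_fromBlocks_zero₁₂, Matrix.det_one, Matrix.det_one, one_mul]
  rw [gramVolume_eq, gramVolume_eq, gramVolume_eq,
    ← Real.sqrt_mul (Matrix.posSemidef_gram ℝ c).det_nonneg,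
    ← Matrix.det_submatrix_equiv_self finSumFinEquiv, hgram, Matrix.det_mul, Matrix.det_mul,
    Matrix.det_transpose, hT, Matrix.det_fromBlocks_zero₁₂]
  ring_nf

theorem det_eq_mul {M : Submodule ℤ (Space n)} (hM : IsLattice M) {W : Submodule ℝ (Space n)}
    (hW : IsLatticeSubspace M W) : det M = det (inter M W) * det (proj M Wᗮ) := by
  obtain ⟨d, c, hc⟩ := hM.inter W
  obtain ⟨e, u, hu⟩ := hM.proj_orthogonal hW
  choose v hvM hv using fun j => mem_proj.1 (hu.mem j)
  have hWc : Submodule.span ℝ (Set.range c) = W := by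
    rw [hc.span_eq, isLatticeSubspace_iff.1 hW]
  have hcM : ∀ i, c i ∈ inter M W := hc.mem
  -- A basis of M ∩ W together with lifts of a basis of the projection generates M: subtracting the
  -- right lifts from m leaves a vector killed by the projection, hence in W.
  have hspan : Submodule.span ℤ (Set.range (Fin.append c v)) = M := by
    refine le_antisymm (Submodule.span_le.2 ?_) fun m hm => ?_
    · rintro _ ⟨i, rfl⟩
      refine Fin.addCases (fun i => ?_) (fun i => ?_) i
      · simpa using (hcM i).1
      · simpa using hvM i
    · have h1 : Wᗮ.starProjection m ∈ proj M Wᗮ := mem_proj.2 ⟨m, hm, rfl⟩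
      rw [← hu.2] at h1
      obtain ⟨p, hp⟩ := (Submodule.mem_span_range_iff_exists_fun ℤ).1 h1
      have h2 : m - ∑ j, p j • v j ∈ inter M W := by
        refine ⟨Submodule.sub_mem _ hm (Submodule.sum_mem _ fun j _ =>
          Submodule.smul_mem _ _ (hvM j)), ?_⟩
        refine starProjection_orthogonal_eq_zero_iff.1 ?_
        rw [map_sub, map_sum, ← hp, sub_eq_zero]
        exact Finset.sum_congr rfl fun j _ => by rw [map_zsmul, hv]
      rw [← hc.2] at h2
      have h3 : m = (m - ∑ j, p j • v j) + ∑ j, p j • v j := by abel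
      rw [h3]
      refine Submodule.add_mem _ (Submodule.span_mono ?_ h2) (Submodule.sum_mem _ fun j _ =>
        Submodule.smul_mem _ _ (Submodule.subset_span ⟨Fin.natAdd d j, by simp⟩))
      rintro _ ⟨i, rfl⟩
      exact ⟨Fin.castAdd e i, by simp⟩
  have hrank : finrank ℝ (realSpan M) = d + e := by
    rw [← finrank_realSpan_proj_orthogonal hW.le, hu.finrank_eq, ← hc.finrank_eq,
      isLatticeSubspace_iff.1 hW]
  have hb : IsBasis M (Fin.append c v) := by
    refine ⟨?_, hspan⟩
    rw [linearIndependent_iff_card_le_finrank_span, Fintype.card_fin, Set.finrank,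
      ← Submodule.span_span_of_tower ℤ ℝ, hspan]
    exact hrank.ge
  rw [det_eq_gramVolume hb, det_eq_gramVolume hc, det_eq_gramVolume hu]
  refine gramVolume_append c u v (fun i j => ?_) fun j => ?_
  · have h1 : u j ∈ Wᗮ := by
      rw [← hv]
      exact Submodule.starProjection_apply_mem _ _
    exact h1 _ (hcM i).2
  · rw [hWc, ← hv, starProjection_orthogonal_eq, sub_sub_cancel]
    exact Submodule.starProjection_apply_mem _ _

theorem inter_inter_of_le {M : Submodule ℤ (Space n)} {W U : Submodule ℝ (Space n)}
    (h : W ≤ U) : inter (inter M U) W = inter M W := by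
  ext x
  exact ⟨fun hx => ⟨hx.1.1, hx.2⟩, fun hx => ⟨⟨hx.1, h hx.2⟩, hx.2⟩⟩

theorem IsLatticeSubspace.of_inter {M : Submodule ℤ (Space n)} {W V : Submodule ℝ (Space n)}
    (hW : IsLatticeSubspace M W) (hV : IsLatticeSubspace (inter M W) V) :
    IsLatticeSubspace M V ∧ inter (inter M W) V = inter M V := by
  have hVW : V ≤ W := hV.le.trans (isLatticeSubspace_iff.1 hW).le
  have h := inter_inter_of_le (M := M) hVW
  refine ⟨?_, h⟩
  rw [isLatticeSubspace_iff, ← h]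
  exact isLatticeSubspace_iff.1 hV

/-- Lattice subspaces of `M / (M ∩ W)` lift to lattice subspaces of `M`. -/
theorem IsLatticeSubspace.sup {M : Submodule ℤ (Space n)} (hM : IsLattice M)
    {W V : Submodule ℝ (Space n)} (hW : IsLatticeSubspace M W)
    (hV : IsLatticeSubspace (proj M Wᗮ) V) :
    IsLatticeSubspace M (W ⊔ V) ∧
      finrank ℝ (W ⊔ V : Submodule ℝ (Space n)) = finrank ℝ W + finrank ℝ V ∧
      det (inter M (W ⊔ V)) = det (inter M W) * det (inter (proj M Wᗮ) V) := by
  have hVW : V ≤ Wᗮ := by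
    refine hV.le.trans ?_
    rw [realSpan_proj_orthogonal hW.le]
    exact inf_le_left
  -- Thus M ∩ (W ⊔ V) is an extension of (proj M Wᗮ) ∩ V by M ∩ W, and ranks add while determinants
  -- multiply.
  have hproj : proj (inter M (W ⊔ V)) Wᗮ = inter (proj M Wᗮ) V := by
    ext y
    constructor
    · rintro ⟨x, ⟨hx, hx'⟩, rfl⟩
      refine ⟨mem_proj.2 ⟨x, hx, rfl⟩, ?_⟩
      obtain ⟨w, hw, v, hv, rfl⟩ := Submodule.mem_sup.1 hx'
      change Wᗮ.starProjection (w + v) ∈ V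
      rw [map_add, starProjection_orthogonal_eq_zero_iff.2 hw,
        Submodule.starProjection_eq_self_iff.2 (hVW hv), zero_add]
      exact hv
    · rintro ⟨⟨x, hx, rfl⟩, hxV⟩
      refine mem_proj.2 ⟨x, ⟨hx, ?_⟩, rfl⟩
      refine Submodule.mem_sup.2 ⟨W.starProjection x, Submodule.starProjection_apply_mem _ _,
        Wᗮ.starProjection x, hxV, ?_⟩
      exact Submodule.starProjection_add_starProjection_orthogonal (K := W) x
  have hinter := inter_inter_of_le (M := M) (le_sup_left : W ≤ W ⊔ V)
  have hW' : IsLatticeSubspace (inter M (W ⊔ V)) W := by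
    rw [isLatticeSubspace_iff, hinter]
    exact isLatticeSubspace_iff.1 hW
  have hWle : W ≤ realSpan (inter M (W ⊔ V)) := hW'.le
  refine ⟨isLatticeSubspace_iff.2 (le_antisymm (Submodule.span_le.2 fun x hx => hx.2)
    (sup_le hWle ?_)), ?_, ?_⟩
  · have h1 := realSpan_proj_orthogonal hWle
    rw [hproj, isLatticeSubspace_iff.1 hV] at h1
    exact h1.le.trans inf_le_right
  · have h1 := Submodule.finrank_sup_add_finrank_inf_eq W V
    have h2 : W ⊓ V = ⊥ := by
      rw [eq_bot_iff, ← Submodule.inf_orthogonal_eq_bot W]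
      exact inf_le_inf_left _ hVW
    rw [h2, finrank_bot, add_zero] at h1
    exact h1
  · rw [det_eq_mul (hM.inter (W ⊔ V)) hW', hinter, hproj]

/-! ### Existence and uniqueness of the smoothing parameter. -/

section Smoothing

variable {E : Type*} [NormedAddCommGroup E] [NormedSpace ℝ E] [FiniteDimensional ℝ E]
  (M : Submodule ℤ E) [DiscreteTopology M]

theorem continuousOn_tsum_exp_neg_mul_norm_sq :
    ContinuousOn (fun a : ℝ => ∑' y : M, Real.exp (-a * ‖(y : E)‖ ^ 2)) (Set.Ioi 0) := by
  intro a₀ ha₀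
  have ha₀ : 0 < a₀ := ha₀
  refine ContinuousAt.continuousWithinAt ?_
  refine ContinuousOn.continuousAt (s := Set.Ioi (a₀ / 2)) ?_
    (isOpen_Ioi.mem_nhds (by simpa using ha₀))
  refine continuousOn_tsum (fun y => by fun_prop)
    (summable_exp_neg_mul_norm_sq M (half_pos ha₀)) fun y a ha => ?_
  rw [Real.norm_of_nonneg (Real.exp_nonneg _), Real.exp_le_exp]
  have h1 : 0 ≤ ‖(y : E)‖ ^ 2 := by positivity
  have h2 : a₀ / 2 < a := ha
  nlinarith

theorem tendsto_tsum_exp_neg_mul_norm_sq :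
    Filter.Tendsto (fun a : ℝ => ∑' y : M, Real.exp (-a * ‖(y : E)‖ ^ 2)) Filter.atTop
      (nhds 1) := by
  classical
  have h1 : ∑' y : M, (if y = 0 then (1 : ℝ) else 0) = 1 := tsum_ite_eq 0 _
  rw [← h1]
  refine tendsto_tsum_of_dominated_convergence (summable_exp_neg_mul_norm_sq M one_pos)
    (fun y => ?_) ?_
  · by_cases hy : y = 0
    · simp [hy]
    · rw [if_neg hy]
      have hy' : 0 < ‖(y : E)‖ ^ 2 := by
        have : (y : E) ≠ 0 := by simpa using hy
        positivity
      refine Real.tendsto_exp_atBot.comp ?_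
      exact Filter.Tendsto.atBot_mul_const hy' Filter.tendsto_neg_atTop_atBot
  · filter_upwards [Filter.eventually_ge_atTop 1] with a ha y
    rw [Real.norm_of_nonneg (Real.exp_nonneg _), Real.exp_le_exp]
    have h1 : 0 ≤ ‖(y : E)‖ ^ 2 := by positivity
    nlinarith

theorem exists_hasSum_exp_neg_mul_norm_sq (hM : M ≠ ⊥) :
    ∃ a : ℝ, 0 < a ∧ HasSum (fun y : M => Real.exp (-a * ‖(y : E)‖ ^ 2)) (3 / 2) := by
  obtain ⟨y, hyM, hy⟩ := Submodule.exists_mem_ne_zero_of_ne_bot hM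
  have hy2 : 0 < ‖y‖ ^ 2 := by positivity
  -- With this choice 0 and y alone contribute 1 + exp(-1/4) ≥ 7/4; the sum tends to 1 at infinity,
  -- so it crosses 3/2.
  set a₁ : ℝ := 1 / (4 * ‖y‖ ^ 2) with ha₁
  have ha₁0 : 0 < a₁ := by positivity
  classical
  have h1 : 3 / 2 ≤ ∑' y : M, Real.exp (-a₁ * ‖(y : E)‖ ^ 2) := by
    have h2 := (summable_exp_neg_mul_norm_sq M ha₁0).sum_le_tsum {0, (⟨y, hyM⟩ : M)}
      (fun _ _ => Real.exp_nonneg _)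
    have hne : (0 : M) ≠ ⟨y, hyM⟩ := fun h => hy (congrArg Subtype.val h).symm
    rw [Finset.sum_pair hne] at h2
    refine le_trans ?_ h2
    have h3 : -a₁ * ‖y‖ ^ 2 = -(1 / 4) := by rw [ha₁]; field_simp
    have h4 := Real.add_one_le_exp (-(1 / 4) : ℝ)
    simp only [Submodule.coe_zero, norm_zero, h3]
    norm_num at h4 ⊢
    linarith
  obtain ⟨a₂, ha₂, ha₁₂⟩ := ((tendsto_tsum_exp_neg_mul_norm_sq M).eventually_lt_const
    (show (1 : ℝ) < 3 / 2 by norm_num)).and (Filter.eventually_ge_atTop a₁) |>.exists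
  obtain ⟨a, ha, hsum⟩ := intermediate_value_Icc' ha₁₂
    ((continuousOn_tsum_exp_neg_mul_norm_sq M).mono
      fun x hx => lt_of_lt_of_le ha₁0 hx.1) ⟨ha₂.le, h1⟩
  have ha0 : 0 < a := lt_of_lt_of_le ha₁0 ha.1
  exact ⟨a, ha0, hsum ▸ (summable_exp_neg_mul_norm_sq M ha0).hasSum⟩

end Smoothing

theorem dual_ne_bot {L : Submodule ℤ (Space n)} (hL : IsLattice L) (h0 : L ≠ ⊥) :
    dual L ≠ ⊥ := by
  intro h
  have h1 := realSpan_dual hL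
  rw [h, realSpan, Submodule.bot_coe, Submodule.span_zero_singleton] at h1
  refine h0 (eq_bot_iff.2 fun x hx => ?_)
  have h2 : x ∈ realSpan L := Submodule.subset_span hx
  rw [← h1] at h2
  simpa using h2

/-- The set whose infimum defines the parameter is a singleton: a solution exists by the
intermediate value theorem, and a nonzero dual vector makes the sum strictly decreasing. -/
theorem smoothingParameter_spec {L : Submodule ℤ (Space n)} (hL : IsLattice L) (h0 : L ≠ ⊥) :
    0 < smoothingParameter L ∧ HasSum (fun y : dual L =>
      Real.exp (-Real.pi * ‖smoothingParameter L • (y : Space n)‖ ^ 2)) (3 / 2) := by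
  have hd := hL.dual.discreteTopology
  have hne := dual_ne_bot hL h0
  have key : ∀ s : ℝ, (fun y : dual L => Real.exp (-Real.pi * ‖s • (y : Space n)‖ ^ 2)) =
      fun y : dual L => Real.exp (-(Real.pi * s ^ 2) * ‖(y : Space n)‖ ^ 2) := fun s => by
    funext y
    rw [norm_smul, mul_pow, Real.norm_eq_abs, sq_abs]
    ring_nf
  obtain ⟨y, hyM, hy⟩ := Submodule.exists_mem_ne_zero_of_ne_bot hne
  have hy2 : 0 < ‖y‖ ^ 2 := by positivity
  obtain ⟨a, ha, hsum⟩ := exists_hasSum_exp_neg_mul_norm_sq (dual L) hne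
  have hpi := Real.pi_pos
  set s := Real.sqrt (a / Real.pi)
  have hs : 0 < s := Real.sqrt_pos.2 (by positivity)
  have hs2 : Real.pi * s ^ 2 = a := by
    rw [Real.sq_sqrt (by positivity)]
    field_simp
  have huniq : ∀ t : ℝ, 0 < t → HasSum (fun y : dual L =>
      Real.exp (-(Real.pi * t ^ 2) * ‖(y : Space n)‖ ^ 2)) (3 / 2) → t = s := by
    have hlt : ∀ p q : ℝ, p < q → HasSum (fun y : dual L =>
        Real.exp (-p * ‖(y : Space n)‖ ^ 2)) (3 / 2) → HasSum (fun y : dual L =>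
        Real.exp (-q * ‖(y : Space n)‖ ^ 2)) (3 / 2) → False := fun p q hpq h1 h2 => by
      refine lt_irrefl _ (hasSum_lt (i := ⟨y, hyM⟩) (fun z => ?_) ?_ h2 h1)
      · rw [Real.exp_le_exp]
        have : 0 ≤ ‖(z : Space n)‖ ^ 2 := by positivity
        nlinarith
      · rw [Real.exp_lt_exp]
        simp only
        nlinarith
    intro t ht h
    rcases lt_trichotomy t s with hts | hts | hts
    · exact (hlt _ _ (by gcongr) h (hs2.symm ▸ hsum)).elim
    · exact hts
    · exact (hlt _ _ (by gcongr) (hs2.symm ▸ hsum) h).elim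
  have hη : smoothingParameter L = s := by
    have hset : {t : ℝ | 0 < t ∧ HasSum (fun y : dual L =>
        Real.exp (-Real.pi * ‖t • (y : Space n)‖ ^ 2)) (1 + 1 / 2)} = {s} := by
      ext t
      have h32 : (1 + 1 / 2 : ℝ) = 3 / 2 := by norm_num
      simp only [key, h32, Set.mem_ofPred_eq, Set.mem_singleton_iff]
      refine ⟨fun h => huniq t h.1 h.2, ?_⟩
      rintro rfl
      exact ⟨hs, hs2.symm ▸ hsum⟩
    rw [smoothingParameter, smoothingParameterEps, hset, csInf_singleton]
  rw [hη, key, hs2]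
  exact ⟨hs, hsum⟩

/-- The covering radius is at most `√d · η`. -/
theorem covers_smoothingParameter {L : Submodule ℤ (Space n)} (hL : IsLattice L) (h0 : L ≠ ⊥) :
    Covers L (Real.sqrt (finrank ℝ (realSpan L)) * smoothingParameter L) := by
  obtain ⟨hη, hsum⟩ := smoothingParameter_spec hL h0
  obtain ⟨d, b, hb⟩ := hL
  obtain ⟨w, hw, h⟩ := hb.exists_dual
  have hwspan : ∀ i, w i ∈ realSpan L := fun i => (hw.mem i).1
  -- L may have rank below n, so Poisson summation is carried out inside its span.
  set B : Basis (Fin d) ℝ (realSpan L) :=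
    (Basis.span hb.1).map (LinearEquiv.ofEq _ _ hb.span_eq) with hBdef
  have hB : ∀ i, (B i : Space n) = b i := fun i => by
    simp [hBdef, Basis.span_apply]
  set w' : Fin d → realSpan L := fun i => ⟨w i, hwspan i⟩
  have hw' : ∀ i (x : realSpan L), inner ℝ (w' i) x = B.repr x i := by
    intro i x
    have h1 : inner ℝ (w' i) x = ∑ j, B.repr x j * inner ℝ (w' i) (B j) := by
      conv_lhs => rw [← B.sum_repr x]
      rw [inner_sum]
      exact Finset.sum_congr rfl fun j _ => by rw [real_inner_smul_right]
    have h2 : ∀ j, inner ℝ (w' i) (B j) = if i = j then (1 : ℝ) else 0 := fun j => by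
      rw [Submodule.coe_inner, hB, h]
    simp [h1, h2]
  set e : (Fin d → ℤ) → dual L := fun k =>
    ⟨∑ i, k i • w i, Submodule.sum_mem _ fun i _ => Submodule.smul_mem _ _ (hw.mem i)⟩
  have he : Function.Bijective e := by
    constructor
    · intro k l hkl
      funext j
      have h1 := inner_sum_zsmul h k j
      have h2 : ∑ i, k i • w i = ∑ i, l i • w i := congrArg Subtype.val hkl
      rw [h2, inner_sum_zsmul h l j] at h1
      exact_mod_cast h1.symm
    · rintro ⟨y, hy⟩
      have hy' := hy
      rw [← hw.2] at hy'
      obtain ⟨k, rfl⟩ := (Submodule.mem_span_range_iff_exists_fun ℤ).1 hy'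
      exact ⟨k, rfl⟩
  have hsum' : HasSum (fun k : Fin d → ℤ =>
      Real.exp (-Real.pi * ‖smoothingParameter L • ∑ i, k i • w' i‖ ^ 2)) (3 / 2) := by
    rw [← (Equiv.ofBijective e he).hasSum_iff] at hsum
    convert hsum using 2 with k
    have h1 : ((∑ i, k i • w' i : realSpan L) : Space n) = ∑ i, k i • w i := by
      rw [Submodule.coe_sum]
      rfl
    change Real.exp (-Real.pi *
      ‖smoothingParameter L • ((∑ i, k i • w' i : realSpan L) : Space n)‖ ^ 2) = _
    rw [h1]
    rfl
  intro x hx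
  obtain ⟨v, hv, hvx⟩ := exists_mem_norm_add_le B w' hw' hη le_rfl hsum' (-⟨x, hx⟩)
  refine ⟨v, ?_, ?_⟩
  · obtain ⟨p, rfl⟩ := (Submodule.mem_span_range_iff_exists_fun ℤ).1 hv
    rw [Submodule.coe_sum]
    refine Submodule.sum_mem _ fun i _ => ?_
    rw [Submodule.coe_smul_of_tower, hB]
    exact Submodule.smul_mem _ _ (hb.mem i)
  · rw [norm_sub_rev]
    rw [← sub_eq_add_neg] at hvx
    exact hvx

/-! ### The filtration by almost extremal lattice subspaces. -/

/-- Every nonzero lattice subspace `W` of `M` has `det (M ∩ W)⁻¹ ≤ A ^ dim W`. -/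
def DetBound (M : Submodule ℤ (Space n)) (A : ℝ) : Prop :=
  ∀ W : Submodule ℝ (Space n), IsLatticeSubspace M W → W ≠ ⊥ →
    1 ≤ A ^ finrank ℝ W * det (inter M W)

theorem finrank_pos_of_ne_bot {W : Submodule ℝ (Space n)} (hW : W ≠ ⊥) : 0 < finrank ℝ W := by
  rw [Nat.pos_iff_ne_zero, Ne, Submodule.finrank_eq_zero]
  exact hW

/-- The normalized inverse determinant `det (M ∩ W) ^ (-1 / dim W)`. -/
def invSlope (M : Submodule ℤ (Space n)) (W : Submodule ℝ (Space n)) : ℝ :=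
  det (inter M W) ^ (-(1 / (finrank ℝ W : ℝ)))

theorem invSlope_pos {M : Submodule ℤ (Space n)} (hM : IsLattice M)
    (W : Submodule ℝ (Space n)) : 0 < invSlope M W :=
  Real.rpow_pos_of_pos (det_pos (hM.inter W)) _

theorem invSlope_pow_mul_det {M : Submodule ℤ (Space n)} (hM : IsLattice M)
    {W : Submodule ℝ (Space n)} (hW : W ≠ ⊥) :
    invSlope M W ^ finrank ℝ W * det (inter M W) = 1 := by
  have h := det_pos (hM.inter W)
  have hd : (finrank ℝ W : ℝ) ≠ 0 := by
    exact_mod_cast (finrank_pos_of_ne_bot hW).ne'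
  rw [invSlope, ← Real.rpow_natCast, ← Real.rpow_mul h.le, neg_mul, one_div_mul_cancel hd,
    Real.rpow_neg_one, inv_mul_cancel₀ h.ne']

/-- The power form multiplies well along W ⊔ V; the root form is the one occurring in `etaDet` and
`muDet`. -/
theorem detBound_iff {M : Submodule ℤ (Space n)} (hM : IsLattice M) {A : ℝ} (hA : 0 ≤ A) :
    DetBound M A ↔ ∀ W : Submodule ℝ (Space n), IsLatticeSubspace M W → W ≠ ⊥ →
      invSlope M W ≤ A := by
  refine forall_congr' fun W => forall_congr' fun _ => forall_congr' fun hW => ?_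
  have h := det_pos (hM.inter W)
  rw [← invSlope_pow_mul_det hM hW, mul_le_mul_iff_left₀ h,
    pow_le_pow_iff_left₀ (invSlope_pos hM W).le hA (finrank_pos_of_ne_bot hW).ne']

theorem DetBound.inter {M : Submodule ℤ (Space n)} {A : ℝ} (h : DetBound M A)
    {W : Submodule ℝ (Space n)} (hW : IsLatticeSubspace M W) :
    DetBound (EuclideanLattice.inter M W) A := by
  intro V hV hV0
  obtain ⟨h1, h2⟩ := hW.of_inter hV
  rw [h2]
  exact h V h1 hV0

theorem realSpan_ne_bot {M : Submodule ℤ (Space n)} (h0 : M ≠ ⊥) : realSpan M ≠ ⊥ := by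
  intro h
  refine h0 (eq_bot_iff.2 fun x hx => ?_)
  have h2 : x ∈ realSpan M := Submodule.subset_span hx
  rw [h] at h2
  simpa using h2

theorem isLatticeSubspace_realSpan (M : Submodule ℤ (Space n)) :
    IsLatticeSubspace M (realSpan M) := by
  have h : inter M (realSpan M) = M := inf_eq_left.2 Submodule.subset_span
  rw [isLatticeSubspace_iff, h]

/-- τ is the supremum of the inverse slopes. Taking W within a factor q of it avoids any appeal to
attainment of the maximum. -/
theorem DetBound.exists_almost_tight {M : Submodule ℤ (Space n)} (hM : IsLattice M)
    (h0 : M ≠ ⊥) {A q : ℝ} (hA : 0 < A) (hq : 1 < q) (h : DetBound M A) :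
    ∃ τ, 0 < τ ∧ τ ≤ A ∧ DetBound M τ ∧ ∃ W, IsLatticeSubspace M W ∧ W ≠ ⊥ ∧
      τ ^ finrank ℝ W * det (EuclideanLattice.inter M W) ≤ q ^ finrank ℝ W := by
  set T : Set ℝ := {t | ∃ W, IsLatticeSubspace M W ∧ W ≠ ⊥ ∧ invSlope M W = t}
  have hle : ∀ t ∈ T, t ≤ A := by
    rintro _ ⟨W, hW, hW0, rfl⟩
    exact (detBound_iff hM hA.le).1 h W hW hW0
  have hbdd : BddAbove T := ⟨A, hle⟩
  have hne : T.Nonempty := ⟨_, _, isLatticeSubspace_realSpan M, realSpan_ne_bot h0, rfl⟩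
  have hτ : 0 < sSup T :=
    (invSlope_pos hM _).trans_le (le_csSup hbdd
      ⟨_, isLatticeSubspace_realSpan M, realSpan_ne_bot h0, rfl⟩)
  refine ⟨sSup T, hτ, csSup_le hne hle, (detBound_iff hM hτ.le).2 fun W hW hW0 =>
    le_csSup hbdd ⟨W, hW, hW0, rfl⟩, ?_⟩
  obtain ⟨_, ⟨W, hW, hW0, rfl⟩, hlt⟩ := exists_lt_of_lt_csSup hne (div_lt_self hτ hq)
  refine ⟨W, hW, hW0, ?_⟩
  rw [div_lt_iff₀ (by linarith)] at hlt
  have hd := det_pos (hM.inter W)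
  calc sSup T ^ finrank ℝ W * det (EuclideanLattice.inter M W)
      ≤ (invSlope M W * q) ^ finrank ℝ W * det (EuclideanLattice.inter M W) := by gcongr
    _ = q ^ finrank ℝ W * (invSlope M W ^ finrank ℝ W * det (EuclideanLattice.inter M W)) := by
        rw [mul_pow]; ring
    _ = q ^ finrank ℝ W := by rw [invSlope_pow_mul_det hM hW0, mul_one]

/-- The bound for W ⊔ V is the product of the contributions of W and V. Near extremality caps that
of W by q^(dim W), so V must supply the rest. -/
theorem DetBound.proj_orthogonal {M : Submodule ℤ (Space n)} (hM : IsLattice M) {τ q : ℝ}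
    (hτ : 0 < τ) (hq : 1 ≤ q) (h : DetBound M τ) {W : Submodule ℝ (Space n)}
    (hW : IsLatticeSubspace M W)
    (hWq : τ ^ finrank ℝ W * det (EuclideanLattice.inter M W) ≤ q ^ finrank ℝ W) :
    DetBound (proj M Wᗮ) (τ * q ^ finrank ℝ W) := by
  intro V hV hV0
  obtain ⟨hU, hUd, hUdet⟩ := hW.sup hM hV
  have h1 := h _ hU (ne_bot_of_le_ne_bot hV0 le_sup_right)
  rw [hUd, hUdet, pow_add] at h1
  have hV1 := finrank_pos_of_ne_bot hV0
  have hdV := det_pos ((hM.proj_orthogonal hW).inter V)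
  set d := finrank ℝ W
  have hqd : 1 ≤ q ^ d := one_le_pow₀ hq
  calc (1 : ℝ) ≤ (τ ^ d * det (EuclideanLattice.inter M W)) * (τ ^ finrank ℝ V *
        det (EuclideanLattice.inter (proj M Wᗮ) V)) := by linarith
    _ ≤ (q ^ d) ^ finrank ℝ V * (τ ^ finrank ℝ V *
        det (EuclideanLattice.inter (proj M Wᗮ) V)) := by
        gcongr
        exact hWq.trans (le_self_pow₀ hqd hV1.ne')
    _ = _ := by rw [mul_pow]; ring

theorem Covers.mono {L : Submodule ℤ (Space n)} {r s : ℝ} (h : Covers L r) (hrs : r ≤ s) :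
    Covers L s := fun x hx => by
  obtain ⟨v, hv, hvr⟩ := h x hx
  exact ⟨v, hv, hvr.trans hrs⟩

theorem div_le_sum_range_inv (D d : ℕ) :
    (d : ℝ) / (D + d) ≤ ∑ j ∈ Finset.range d, 1 / ((D : ℝ) + j + 1) := by
  have h : ∑ _j ∈ Finset.range d, 1 / ((D : ℝ) + d) = d / (D + d) := by
    rw [Finset.sum_const, Finset.card_range, nsmul_eq_mul, mul_one_div]
  rw [← h]
  refine Finset.sum_le_sum fun j hj => ?_
  have hj' : (j : ℝ) + 1 ≤ d := by exact_mod_cast Finset.mem_range.1 hj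
  exact one_div_le_one_div_of_le (by positivity) (by linarith)

/-- 1/P is the determinant of the part already removed and δ that of the new piece. The first
hypotheses give τ^(D+d) ≤ 2P/δ, and the definition of K bounds P/δ; the 2 is the total loss from
powers of q. -/
theorem add_mul_sq_le_of_tight {D d : ℕ} (hd : 0 < d) {τ P Q q δ K : ℝ} (hτ : 0 < τ) (hP : 0 < P)
    (hQ : 0 ≤ Q) (hδ : 0 < δ) (hQq : Q * q ^ d ≤ 2)
    (h1 : τ ^ D ≤ P * Q) (h2 : τ ^ d * δ ≤ q ^ d)
    (h3 : P ^ 2 * ((D + d : ℕ) : ℝ) ^ (D + d) ≤ K ^ (2 * (D + d)) * δ ^ 2) :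
    ((D + d : ℕ) : ℝ) * τ ^ 2 ≤ 4 * K ^ 2 := by
  set e := D + d with he
  have he0 : e ≠ 0 := by omega
  have h4 : τ ^ e * δ ≤ 2 * P := by
    calc τ ^ e * δ = τ ^ D * (τ ^ d * δ) := by rw [he, pow_add]; ring
      _ ≤ (P * Q) * q ^ d := by gcongr
      _ = P * (Q * q ^ d) := by ring
      _ ≤ P * 2 := by gcongr
      _ = 2 * P := by ring
  have h5 : (τ ^ e * δ) ^ 2 ≤ (2 * P) ^ 2 := by gcongr
  have h6 : ((e : ℝ) * τ ^ 2) ^ e * δ ^ 2 ≤ (4 * K ^ (2 * e)) * δ ^ 2 := by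
    calc ((e : ℝ) * τ ^ 2) ^ e * δ ^ 2 = (e : ℝ) ^ e * (τ ^ e * δ) ^ 2 := by
          rw [mul_pow, mul_pow, ← pow_mul, ← pow_mul, mul_comm 2 e]; ring
      _ ≤ (e : ℝ) ^ e * (2 * P) ^ 2 := by gcongr
      _ = 4 * (P ^ 2 * (e : ℝ) ^ e) := by ring
      _ ≤ 4 * (K ^ (2 * e) * δ ^ 2) := by gcongr
      _ = _ := by ring
  have h7 := le_of_mul_le_mul_right h6 (by positivity)
  have h8 : 4 * K ^ (2 * e) ≤ (4 * K ^ 2) ^ e := by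
    rw [mul_pow, ← pow_mul]
    have : (4 : ℝ) ≤ 4 ^ e := le_self_pow₀ (by norm_num) he0
    have hK : 0 ≤ K ^ (2 * e) := by rw [pow_mul]; positivity
    gcongr
  exact (pow_le_pow_iff_left₀ (by positivity) (by positivity) he0).1 (h7.trans h8)

/-- The new piece pays for exactly the first d terms of the harmonic sum starting after D, and the
recursion pays for the remaining m - d. -/
theorem sqrt_sq_add_sq_le {D d m : ℕ} (hd : 0 < d) (hdm : d ≤ m) {C K τ η : ℝ} (hC : 0 ≤ C)
    (hK : 0 ≤ K) (hη0 : 0 ≤ η) (hη : η ≤ C * τ)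
    (hkey : ((D + d : ℕ) : ℝ) * τ ^ 2 ≤ 4 * K ^ 2) :
    Real.sqrt ((Real.sqrt d * η) ^ 2 + (2 * C * K * Real.sqrt
      (∑ j ∈ Finset.range (m - d), 1 / (((D + d : ℕ) : ℝ) + j + 1))) ^ 2) ≤
    2 * C * K * Real.sqrt (∑ j ∈ Finset.range m, 1 / ((D : ℝ) + j + 1)) := by
  refine Real.sqrt_le_iff.2 ⟨by positivity, ?_⟩
  have hsum1 : (0 : ℝ) ≤ ∑ j ∈ Finset.range (m - d), 1 / (((D + d : ℕ) : ℝ) + j + 1) :=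
    Finset.sum_nonneg fun _ _ => by positivity
  have hsum2 : (0 : ℝ) ≤ ∑ j ∈ Finset.range m, 1 / ((D : ℝ) + j + 1) :=
    Finset.sum_nonneg fun _ _ => by positivity
  rw [mul_pow (Real.sqrt _) η, mul_pow (2 * C * K), mul_pow (2 * C * K),
    Real.sq_sqrt (Nat.cast_nonneg _), Real.sq_sqrt hsum1, Real.sq_sqrt hsum2]
  have hsplit : ∑ j ∈ Finset.range m, 1 / ((D : ℝ) + j + 1) =
      ∑ j ∈ Finset.range d, 1 / ((D : ℝ) + j + 1) +
        ∑ j ∈ Finset.range (m - d), 1 / (((D + d : ℕ) : ℝ) + j + 1) := by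
    have h1 : m = d + (m - d) := by omega
    conv_lhs => rw [h1, Finset.sum_range_add]
    congr 1
    refine Finset.sum_congr rfl fun j _ => ?_
    push_cast
    ring
  have hDd : (0 : ℝ) < ((D + d : ℕ) : ℝ) := by exact_mod_cast (by omega : 0 < D + d)
  have h1 : (d : ℝ) * η ^ 2 ≤
      (2 * C * K) ^ 2 * ∑ j ∈ Finset.range d, 1 / ((D : ℝ) + j + 1) := by
    have h2 := div_le_sum_range_inv D d
    calc (d : ℝ) * η ^ 2 ≤ d * (C * τ) ^ 2 := by gcongr
      _ = C ^ 2 * (((D + d : ℕ) : ℝ) * τ ^ 2) * (d / ((D + d : ℕ) : ℝ)) := by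
          field_simp
      _ ≤ C ^ 2 * (4 * K ^ 2) * (d / ((D + d : ℕ) : ℝ)) := by gcongr
      _ = (2 * C * K) ^ 2 * (d / (D + d)) := by push_cast; ring
      _ ≤ _ := by gcongr
  rw [hsplit]
  calc _ ≤ (2 * C * K) ^ 2 * ∑ j ∈ Finset.range d, 1 / ((D : ℝ) + j + 1) +
        (2 * C * K) ^ 2 * ∑ j ∈ Finset.range (m - d), 1 / (((D + d : ℕ) : ℝ) + j + 1) := by
        gcongr
    _ = _ := by ring

/-- Peeling off almost extremal lattice subspaces of `M` bounds the covering radius of the dual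
lattice by a harmonic sum. -/
theorem covers_dual_of_detBound {C K q : ℝ} (hC : 0 ≤ C) (hK : 0 ≤ K) (hq : 1 < q)
    (hsm : ∀ M : Submodule ℤ (Space n), IsLattice M → M ≠ ⊥ → ∀ A : ℝ, 0 < A → DetBound M A →
      smoothingParameter (dual M) ≤ C * A) (N m : ℕ) :
    ∀ (D : ℕ) (M : Submodule ℤ (Space n)) (A P Q : ℝ), IsLattice M →
      finrank ℝ (realSpan M) = m → D + m ≤ N → 0 < A → 0 < P → 1 ≤ Q →
      Q * q ^ (m * (N + 1)) ≤ 2 → DetBound M A → A ^ D ≤ P * Q →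
      (∀ W, IsLatticeSubspace M W → W ≠ ⊥ →
        P ^ 2 * ((D + finrank ℝ W : ℕ) : ℝ) ^ (D + finrank ℝ W) ≤
          K ^ (2 * (D + finrank ℝ W)) * det (inter M W) ^ 2) →
      Covers (dual M) (2 * C * K * Real.sqrt (∑ j ∈ Finset.range m, 1 / ((D : ℝ) + j + 1))) := by
  -- Invariants: D dimensions are already removed, with inverse determinant P; A bounds the current
  -- inverse slopes; Q collects the powers of q lost so far. The last hypothesis is the K-bound of
  -- the original lattice on subspaces containing the removed part.
  induction m using Nat.strong_induction_on with
  | _ m ih =>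
  intro D M A P Q hM hm hDm hA hP hQ hQq hMA hAPQ hMK
  rcases Nat.eq_zero_or_pos m with hm0 | hm0
  · intro x hx
    rw [hm0, Submodule.finrank_eq_zero] at hm
    rw [realSpan_dual hM, hm, Submodule.mem_bot] at hx
    refine ⟨0, Submodule.zero_mem _, ?_⟩
    rw [hx, sub_zero, norm_zero]
    positivity
  have hM0 : M ≠ ⊥ := by
    rintro rfl
    rw [realSpan, Submodule.bot_coe, Submodule.span_zero_singleton, finrank_bot] at hm
    omega
  obtain ⟨τ, hτ, hτA, hMτ, W, hW, hW0, hWq⟩ := hMA.exists_almost_tight hM hM0 hA hq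
  have hd := finrank_pos_of_ne_bot hW0
  have hdm := finrank_realSpan_proj_orthogonal hW.le
  have hδ := det_pos (hM.inter W)
  have hMKW := hMK W hW hW0
  have hNq := hMτ.proj_orthogonal hM hτ hq.le hW hWq
  have hq0 : 0 < q := by linarith
  set d := finrank ℝ W with hd_def
  set δ := det (inter M W)
  rw [hm] at hdm
  have hdm' : finrank ℝ (realSpan (proj M Wᗮ)) = m - d := by omega
  have hτPQ : τ ^ D ≤ P * Q := le_trans (by gcongr) hAPQ
  have hkey : ((D + d : ℕ) : ℝ) * τ ^ 2 ≤ 4 * K ^ 2 := by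
    refine add_mul_sq_le_of_tight hd hτ hP (by linarith) hδ (le_trans ?_ hQq) hτPQ hWq hMKW
    gcongr
    · exact hq.le
    · calc d ≤ m := by omega
        _ ≤ m * (N + 1) := Nat.le_mul_of_pos_right _ (Nat.succ_pos _)
  have hM1 : inter M W ≠ ⊥ := by
    intro h
    have h1 := isLatticeSubspace_iff.1 hW
    rw [h, realSpan, Submodule.bot_coe, Submodule.span_zero_singleton] at h1
    exact hW0 h1.symm
  have hc1 := covers_smoothingParameter (hM.inter W).dual (dual_ne_bot (hM.inter W) hM1)
  rw [realSpan_dual (hM.inter W), isLatticeSubspace_iff.1 hW] at hc1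
  have hη := hsm _ (hM.inter W) hM1 τ hτ (hMτ.inter hW)
  have hη0 := (smoothingParameter_spec (hM.inter W).dual (dual_ne_bot (hM.inter W) hM1)).1
  have hc2 := ih (m - d) (by omega) (D + d) (proj M Wᗮ) (τ * q ^ d) (P / δ)
    (Q * q ^ (d * (D + d + 1))) (hM.proj_orthogonal hW) hdm' (by omega) (by positivity)
    (by positivity) (one_le_mul_of_one_le_of_one_le hQ (one_le_pow₀ hq.le))
    (by
      refine le_trans ?_ hQq
      rw [mul_assoc, ← pow_add]
      -- The exponent m(N+1) is a loss budget: removing d dimensions spends d(D+d+1) of it, at most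
      -- d(N+1) because D + d ≤ N.
      have h1 : d * (D + d + 1) + (m - d) * (N + 1) ≤ m * (N + 1) := by
        calc d * (D + d + 1) + (m - d) * (N + 1) ≤ d * (N + 1) + (m - d) * (N + 1) := by
              gcongr; omega
          _ = m * (N + 1) := by rw [← add_mul]; congr 1; omega
      gcongr
      exact hq.le)
    hNq
    (by
      calc (τ * q ^ d) ^ (D + d) = τ ^ D * (τ ^ d * δ) / δ * q ^ (d * (D + d)) := by
            rw [mul_pow, ← pow_mul, pow_add τ]
            field_simp
        _ ≤ (P * Q) * q ^ d / δ * q ^ (d * (D + d)) := by gcongr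
        _ = P / δ * (Q * q ^ (d * (D + d + 1))) := by
            rw [show d * (D + d + 1) = d + d * (D + d) by ring, pow_add]
            ring)
    (by
      intro V hV hV0
      obtain ⟨hU, hUd, hUdet⟩ := hW.sup hM hV
      have h1 := hMK _ hU (ne_bot_of_le_ne_bot hV0 le_sup_right)
      rw [hUd, hUdet, ← add_assoc] at h1
      rw [div_pow, div_mul_eq_mul_div, div_le_iff₀ (by positivity)]
      calc _ ≤ _ := h1
        _ = _ := by ring)
  refine (Covers.dual hM hW hc1 hc2).mono
    (sqrt_sq_add_sq_le hd (by omega) hC hK hη0.le hη hkey)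

/-! ### Passage to the extended-real constants. -/

theorem ofReal_smoothingParameter_dual_le {M : Submodule ℤ (Space n)} (hM : IsLattice M)
    (h0 : M ≠ ⊥) {A : ℝ} (hA : 0 < A) (h : DetBound M A) :
    ENNReal.ofReal (smoothingParameter (dual M)) ≤ Ceta n * ENNReal.ofReal A := by
  have hA0 : ENNReal.ofReal A ≠ 0 := by simpa using hA
  have heta : etaDet (dual M) ≤ ENNReal.ofReal A := by
    refine iSup_le fun W => iSup_le fun hW => iSup_le fun hW0 => ?_
    rw [dual_dual hM] at hW ⊢
    exact ENNReal.ofReal_le_ofReal ((detBound_iff hM hA.le).1 h W hW hW0)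
  -- Dividing by A isolates the infimum `Ceta n`, which is then tested against each admissible C.
  rw [← ENNReal.div_le_iff hA0 ENNReal.ofReal_ne_top]
  refine le_sInf fun C hC => ENNReal.div_le_of_le_mul ?_
  refine (hC (dual M) hM.dual (dual_ne_bot hM h0)).trans ?_
  gcongr

theorem smoothingParameter_dual_le (hC : Ceta n ≠ ⊤) {M : Submodule ℤ (Space n)}
    (hM : IsLattice M) (h0 : M ≠ ⊥) {A : ℝ} (hA : 0 < A) (h : DetBound M A) :
    smoothingParameter (dual M) ≤ (Ceta n).toReal * A := by
  have h1 := ofReal_smoothingParameter_dual_le hM h0 hA h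
  rw [← ENNReal.ofReal_toReal hC, ← ENNReal.ofReal_mul ENNReal.toReal_nonneg] at h1
  exact (ENNReal.ofReal_le_ofReal_iff (by positivity)).1 h1

/-- Since 0 · ∞ = 0, the case of infinite `muDet` is trivial only if `Ceta n` is nonzero; a rank-one
lattice shows this. `muDet_ne_zero` does the same for infinite `Ceta n`. -/
theorem Ceta_ne_zero (hn : n ≠ 0) : Ceta n ≠ 0 := by
  have : NeZero n := ⟨hn⟩
  set e : Space n := EuclideanSpace.single 0 1
  have he : e ≠ 0 := by simp [e]
  set M : Submodule ℤ (Space n) := Submodule.span ℤ (Set.range fun _ : Fin 1 => e)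
  have hb : IsBasis M fun _ : Fin 1 => e :=
    ⟨linearIndependent_unique_iff.2 he, rfl⟩
  have hM : IsLattice M := ⟨1, _, hb⟩
  have hM0 : M ≠ ⊥ := fun h => he (by simpa [h] using hb.mem 0)
  have hδ := det_pos (hM.inter (realSpan M))
  have hbound : DetBound M (det (inter M (realSpan M)))⁻¹ := by
    intro W hW hW0
    have h1 := finrank_pos_of_ne_bot hW0
    have h2 : W = realSpan M :=
      Submodule.eq_of_le_of_finrank_le hW.le (by rw [hb.finrank_eq]; omega)
    rw [h2, hb.finrank_eq, pow_one, inv_mul_cancel₀ hδ.ne']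
  intro h
  have h1 := ofReal_smoothingParameter_dual_le hM hM0 (inv_pos.2 hδ) hbound
  rw [h, zero_mul, nonpos_iff_eq_zero, ENNReal.ofReal_eq_zero] at h1
  exact absurd (smoothingParameter_spec hM.dual (dual_ne_bot hM hM0)).1 (not_lt.2 h1)

theorem muDet_ne_zero {L : Submodule ℤ (Space n)} (hL : IsLattice L) (h0 : L ≠ ⊥) :
    muDet L ≠ 0 := by
  have hne := realSpan_ne_bot (dual_ne_bot hL h0)
  have hd := finrank_pos_of_ne_bot hne
  have hle : ENNReal.ofReal (Real.sqrt (finrank ℝ (realSpan (dual L))) *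
      invSlope (dual L) (realSpan (dual L))) ≤ muDet L :=
    le_iSup₂_of_le (realSpan (dual L)) (isLatticeSubspace_realSpan _)
      (le_iSup_of_le hd le_rfl)
  intro h
  rw [h, nonpos_iff_eq_zero, ENNReal.ofReal_eq_zero] at hle
  have h1 := invSlope_pos hL.dual (realSpan (dual L))
  have h2 : 0 < Real.sqrt (finrank ℝ (realSpan (dual L))) :=
    Real.sqrt_pos.2 (by exact_mod_cast hd)
  exact absurd (mul_pos h2 h1) (not_lt.2 hle)

theorem sqrt_mul_invSlope_le_muDet {L : Submodule ℤ (Space n)} (hμ : muDet L ≠ ⊤)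
    {W : Submodule ℝ (Space n)} (hW : IsLatticeSubspace (dual L) W) (hW0 : W ≠ ⊥) :
    Real.sqrt (finrank ℝ W) * invSlope (dual L) W ≤ (muDet L).toReal := by
  rw [← ENNReal.ofReal_le_iff_le_toReal hμ]
  exact le_iSup₂_of_le W hW (le_iSup_of_le (finrank_pos_of_ne_bot hW0) le_rfl)

theorem sum_range_inv_le (m : ℕ) :
    ∑ j ∈ Finset.range m, 1 / (((0 : ℕ) : ℝ) + j + 1) ≤ 1 + Real.log m := by
  have h := harmonic_le_one_add_log m
  rw [harmonic] at h
  push_cast at h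
  refine le_trans (le_of_eq (Finset.sum_congr rfl fun j _ => ?_)) h
  simp

/-- The covering radius bound with real constants. -/
theorem coveringRadius_le_of_ne_top (hn : 2 ≤ n) (hC : Ceta n ≠ ⊤) {L : Submodule ℤ (Space n)}
    (hL : IsLattice L) (h0 : L ≠ ⊥) (hμ : muDet L ≠ ⊤) :
    coveringRadius L ≤ 6 * Real.log n * (Ceta n).toReal * (muDet L).toReal := by
  set C := (Ceta n).toReal
  set K := (muDet L).toReal
  have hC0 : 0 ≤ C := ENNReal.toReal_nonneg
  have hK : 0 < K := ENNReal.toReal_pos (muDet_ne_zero hL h0) hμ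
  set M := dual L
  have hM : IsLattice M := hL.dual
  have hslope : ∀ W, IsLatticeSubspace M W → W ≠ ⊥ →
      Real.sqrt (finrank ℝ W) * invSlope M W ≤ K := fun W hW hW0 =>
    sqrt_mul_invSlope_le_muDet hμ hW hW0
  have hMK : DetBound M K := by
    refine (detBound_iff hM hK.le).2 fun W hW hW0 => le_trans ?_ (hslope W hW hW0)
    have h1 : (1 : ℝ) ≤ Real.sqrt (finrank ℝ W) := by
      rw [Real.one_le_sqrt]
      exact_mod_cast finrank_pos_of_ne_bot hW0
    exact le_mul_of_one_le_left (invSlope_pos hM W).le h1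
  set m := finrank ℝ (realSpan M)
  have hmn : m ≤ n := by simpa using Submodule.finrank_le (realSpan M)
  -- q is the k-th root of 2, so the whole loss budget stays below 2; the final +1 keeps k nonzero.
  set k := m * (n + 1) + 1 with hk
  set q : ℝ := 2 ^ (1 / (k : ℝ))
  have hk0 : (k : ℝ) ≠ 0 := by positivity
  have hq : 1 < q := Real.one_lt_rpow (by norm_num) (by positivity)
  have hqk : q ^ k = 2 := by
    rw [← Real.rpow_natCast, ← Real.rpow_mul (by norm_num), one_div_mul_cancel hk0,
      Real.rpow_one]
  have hcov := covers_dual_of_detBound hC0 hK.le hq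
    (fun M hM hM0 A hA h => smoothingParameter_dual_le hC hM hM0 hA h) n m 0 M K 1 1 hM rfl
    (by omega) hK one_pos le_rfl
    (by
      rw [one_mul, ← hqk]
      exact pow_le_pow_right₀ hq.le (by omega))
    hMK (by simp)
    (by
      intro W hW hW0
      have h1 := hslope W hW hW0
      have h2 := invSlope_pow_mul_det hM hW0
      have h3 := invSlope_pos hM W
      rw [zero_add, one_pow, one_mul]
      set d := finrank ℝ W
      calc (d : ℝ) ^ d = (Real.sqrt d ^ 2) ^ d * (invSlope M W ^ d * det (inter M W)) ^ 2 := by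
            rw [h2, Real.sq_sqrt (Nat.cast_nonneg _), one_pow, mul_one]
        _ = (Real.sqrt d * invSlope M W) ^ (2 * d) * det (inter M W) ^ 2 := by
            rw [mul_pow, mul_pow, pow_mul, pow_mul, ← pow_mul _ d 2, mul_comm d 2, pow_mul]
            ring
        _ ≤ K ^ (2 * d) * det (inter M W) ^ 2 := by gcongr)
  rw [dual_dual hL] at hcov
  refine (coveringRadius_le (by positivity) hcov).trans ?_
  have hlog2 : Real.log 2 ≤ Real.log n :=
    Real.log_le_log (by norm_num) (by exact_mod_cast hn)
  have hl := Real.log_two_gt_d9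
  have hlogm : Real.log m ≤ Real.log n := by
    rcases Nat.eq_zero_or_pos m with h | h
    · rw [h, Nat.cast_zero, Real.log_zero]
      linarith
    · exact Real.log_le_log (by exact_mod_cast h) (by exact_mod_cast hmn)
  -- Here √(1 + log n) is weakened to 3 log n, using log n ≥ log 2; with the factor 2 this gives the
  -- constant 6.
  have hsqrt : Real.sqrt (∑ j ∈ Finset.range m, 1 / (((0 : ℕ) : ℝ) + j + 1)) ≤
      3 * Real.log n := by
    refine Real.sqrt_le_iff.2 ⟨by linarith, (sum_range_inv_le m).trans ?_⟩
    nlinarith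
  calc 2 * C * K * Real.sqrt (∑ j ∈ Finset.range m, 1 / (((0 : ℕ) : ℝ) + j + 1))
      ≤ 2 * C * K * (3 * Real.log n) := by gcongr
    _ = _ := by ring

theorem ofReal_coveringRadius_le (hn : 2 ≤ n) {L : Submodule ℤ (Space n)} (hL : IsLattice L)
    (h0 : L ≠ ⊥) : ENNReal.ofReal (coveringRadius L) ≤
      ENNReal.ofReal (6 * Real.log n) * Ceta n * muDet L := by
  have hlog : 0 < Real.log n := Real.log_pos (by exact_mod_cast hn)
  have hl0 : ENNReal.ofReal (6 * Real.log n) ≠ 0 := by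
    rw [Ne, ENNReal.ofReal_eq_zero, not_le]
    positivity
  have hC0 : Ceta n ≠ 0 := Ceta_ne_zero (by omega)
  by_cases hC : Ceta n = ⊤
  · rw [hC, ENNReal.mul_top hl0, ENNReal.top_mul (muDet_ne_zero hL h0)]
    exact le_top
  by_cases hμ : muDet L = ⊤
  · rw [hμ, ENNReal.mul_top (mul_ne_zero hl0 hC0)]
    exact le_top
  rw [← ENNReal.ofReal_toReal hC, ← ENNReal.ofReal_toReal hμ,
    ← ENNReal.ofReal_mul (by positivity), ← ENNReal.ofReal_mul (by positivity)]
  exact ENNReal.ofReal_le_ofReal (coveringRadius_le_of_ne_top hn hC hL h0 hμ)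

theorem CKL_le (hn : 2 ≤ n) : CKL n ≤ ENNReal.ofReal (6 * Real.log n) * Ceta n :=
  sInf_le fun _ hL h0 => ofReal_coveringRadius_le hn hL h0

theorem PolylogBounded.CKL (h : PolylogBounded Ceta) : PolylogBounded CKL := by
  obtain ⟨p, hp⟩ := h
  refine ⟨Polynomial.C 6 * Polynomial.X * p, fun n hn => ?_⟩
  have hlog : 0 < Real.log n := Real.log_pos (by exact_mod_cast hn)
  rw [Polynomial.eval_mul, Polynomial.eval_mul, Polynomial.eval_C, Polynomial.eval_X,
    ENNReal.ofReal_mul (by positivity)]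
  exact (CKL_le hn).trans (by gcongr; exact hp n hn)

end EuclideanLattice

end

theorem mainTheorem1 :
    (∃ c : ℝ, 0 < c ∧ ∀ n : ℕ, 2 ≤ n →
      EuclideanLattice.CKL n ≤ ENNReal.ofReal (c * Real.log n) * EuclideanLattice.Ceta n ∧
      ∀ L : Submodule ℤ (EuclideanLattice.Space n),
        EuclideanLattice.IsLattice L → L ≠ ⊥ →
        ENNReal.ofReal (EuclideanLattice.coveringRadius L) ≤
          ENNReal.ofReal (c * Real.log n) * EuclideanLattice.Ceta n *
            EuclideanLattice.muDet L) ∧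
    (EuclideanLattice.PolylogBounded EuclideanLattice.Ceta →
      EuclideanLattice.PolylogBounded EuclideanLattice.CKL) :=
  ⟨⟨6, by norm_num, fun _ hn => ⟨EuclideanLattice.CKL_le hn, fun _ hL h0 =>
    EuclideanLattice.ofReal_coveringRadius_le hn hL h0⟩⟩,
    EuclideanLattice.PolylogBounded.CKL⟩
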